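/- Let $\mathbb F$ be the free group with $m$ generators, $|s|$ the word length of $s\in\mathbb F$, $n\ge 1$, $S_n=\{s\in\mathbb F:|s|\le n\}$, and let $\mathcal H$ be a complex Hilbert space. A function $\varphi:S_n\to\mathcal L(\mathcal H)$ (or $\Phi:\mathbb F\to\mathcal L(\mathcal H)$) is called positive definite if $[\varphi(s_i^{-1}s_j)]_{i,j=1}^k\ge 0$ whenever all $s_i$ and all $s_i^{-1}s_j$ lie in the domain of definition. **Lexicographic orders.** A total order $\preceq$ on $\mathbb F$ is lexicographic if $s\preceq t$ whenever $|s|<|t|$, or $|s|=|t|$ and, after the longest common beginning of the reduced words of $s\ne t$, the next letters $a$ of $s$ and $b$ of $t$ satisfy $a\preceq b$. Classes $\{s,s^{-1}\}$ are ordered through their smallest elements. For a class $\nu=\{r,r^{-1}\}$ with $r\preceq r^{-1}$, let $\Gamma_\nu$ be the graph on $\mathbb F$ in which $s\ne t$ are adjacent iff the class of $s^{-1}t$ precedes or equals $\nu$. **Central extension.** A realization of a positive block matrix $A=(A_{ij})_{i,j\in I}$ with entries in $\mathcal L(\mathcal H)$ consists of a Hilbert space $\mathcal R(A)$ and operators $\omega_i:\mathcal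 H\to\mathcal R(A)$ whose ranges span $\mathcal R(A)$, with $A_{ij}=\omega_i^*\omega_j$; it is unique up to a unitary. For $J\subset I$, $\mathcal R(A|J)$ is the closed span of the $\omega_i\mathcal H$, $i\in J$. Let $\Phi:\mathbb F\to\mathcal L(\mathcal H)$ be positive definite, let $\nu=\{r,r^{-1}\}$ be as above with $r\ne e$, let $C$ be the maximal clique of $\Gamma_\nu$ containing $e$ and $r$, and $A=[\Phi(s^{-1}t)]_{s,t\in C}$. The parameter $\gamma_\nu$ of $\Phi$ is the restriction of the orthogonal projection onto $\mathcal R(A|C\setminus\{e\})\ominus\mathcal R(A|C\setminus\{e,r\})$ to $\mathcal R(A|C\setminus\{r\})\ominus\mathcal R(A|C\setminus\{e,r\})$. A central extension of $\varphi:S_n\to\mathcal L(\mathcal H)$ with respect to $\preceq$ is a positive definite $\Phi:\mathbb F\to\mathcal L(\mathcal H)$ extending $\varphi$ with $\gamma_\nu=0$ for all classes $\nu$ of words of length $>n$. **Maximal orthogonality.** Let $(\mathcal K,\pi,V)$ be the minimal Naimark dilation of $\Phi$: $\pi$ is a unitary representation of $\mathbb F$ on $\mathcal K$, $V:\mathcal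 H\to\mathcal K$, $\Phi(s)=V^*\pi(s)V$, and $\mathcal K$ is the closed span of the $\pi(s)V\mathcal H$. For $\Sigma\subset\mathbb F$ let $\mathcal K(\Sigma)$ be the closed span of the $\pi(\sigma)V\mathcal H$, $\sigma\in\Sigma$. For $k\ge n$, $\Phi$ is called maximal $(k+1)$-orthogonal if, whenever $|s^{-1}t|=k+1$ and $\Sigma=\{r\in\mathbb F:\max(|r^{-1}s|,|r^{-1}t|)\le k\}$, $$\bigl(\mathcal K(\Sigma\cup\{s\})\ominus\mathcal K(\Sigma)\bigr)\perp\bigl(\mathcal K(\Sigma\cup\{t\})\ominus\mathcal K(\Sigma)\bigr).$$ **Theorem 5.3.** Let $\varphi:S_n\to\mathcal L(\mathcal H)$ be positive definite. There is a positive definite extension $\Phi:\mathbb F\to\mathcal L(\mathcal H)$ of $\varphi$ such that: 1. for every lexicographic order $\preceq$, $\Phi$ is the unique central extension of $\varphi$ with respect to $\preceq$; thus the central extension does not depend on the order; 2. $\Phi$ is maximal $(k+1)$-orthogonal for every $k\ge n$; 3. every maximal $(n+1)$-orthogonal positive definite extension of $\varphi$ coincides with $\Phi$ on $S_{n+1}$;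 4. $\Phi$ is the only positive definite extension of $\varphi$ that is maximal $(k+1)$-orthogonal for every $k\ge n$. -/

import Mathlib

open scoped ComplexOrder InnerProductSpace

universe u

noncomputable section

/-! ### The free group on `m` generators: word length, balls, lexicographic orders -/

/-- The free group `𝔽` with `m` generators. The word length is `FreeGroup.norm`. -/
abbrev FreeGp (m : ℕ) : Type := FreeGroup (Fin m)

/-- `S_n`, the set of words of length at most `n`. -/
def wordBall (m n : ℕ) : Set (FreeGp m) := {s | s.norm ≤ n}

/-- The group element given by a single letter (a generator or the inverse of a generator). -/
def letter {m : ℕ} (x : Fin m × Bool) : FreeGp m := FreeGroup.mk [x]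

/-- A total order on `𝔽` is lexicographic if shorter words come first, and words of equal length
are compared by comparing (as elements of `𝔽`) the letters that follow the common beginning `w`
of their reduced forms. -/
structure IsLexicographic {m : ℕ} (o : LinearOrder (FreeGp m)) : Prop where
  le_of_norm_lt : ∀ s t : FreeGp m, s.norm < t.norm → o.le s t
  le_of_letter_le : ∀ s t : FreeGp m, s.norm = t.norm →
    ∀ (w v v' : List (Fin m × Bool)) (a b : Fin m × Bool),
      s.toWord = w ++ a :: v → t.toWord = w ++ b :: v' → a ≠ b →
      o.le (letter a) (letter b) → o.le s t

/-- The order on classes `{s, s⁻¹}`: the class of `s` precedes (or equals) the class of `t` iff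
`min {s, s⁻¹} ≤ min {t, t⁻¹}`. -/
def classLE {m : ℕ} (o : LinearOrder (FreeGp m)) (s t : FreeGp m) : Prop :=
  o.le (o.min s s⁻¹) (o.min t t⁻¹)

/-- The graph `Γ_ν`, where `ν = {r, r⁻¹}`: its vertices are the elements of `𝔽`, and distinct `s`
and `t` are adjacent iff the class of `s⁻¹ t` precedes or equals `ν`. -/
def classGraph {m : ℕ} (o : LinearOrder (FreeGp m)) (r : FreeGp m) : SimpleGraph (FreeGp m) where
  Adj s t := s ≠ t ∧ classLE o (s⁻¹ * t) r
  symm := ⟨by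
    rintro s t ⟨hne, h⟩
    refine ⟨hne.symm, ?_⟩
    have e : (t⁻¹ * s) = (s⁻¹ * t)⁻¹ := by group
    unfold classLE at h ⊢
    rw [e, inv_inv, @min_comm _ o]
    exact h⟩
  loopless := ⟨fun _ h => h.1 rfl⟩

section Hilbert

variable {H : Type u} [NormedAddCommGroup H] [InnerProductSpace ℂ H] [CompleteSpace H]

/-! ### Positive definite functions -/

/-- `Φ : 𝔽 → L(H)` is positive definite: all operator matrices `[Φ (s_i⁻¹ s_j)]` are positive
semidefinite, as quadratic forms on the direct sum of `k` copies of `H`. -/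
def IsPosDef {m : ℕ} (Φ : FreeGp m → H →L[ℂ] H) : Prop :=
  ∀ (k : ℕ) (s : Fin k → FreeGp m) (h : Fin k → H),
    0 ≤ ∑ i, ∑ j, ⟪h i, Φ ((s i)⁻¹ * s j) (h j)⟫_ℂ

/-- `φ : S → L(H)` is positive definite: the operator matrix `[φ (s_i⁻¹ s_j)]` is positive
semidefinite whenever `s_1, …, s_k ∈ S` and all the `s_i⁻¹ s_j` belong to `S`. -/
def IsPosDefOn {m : ℕ} {S : Set (FreeGp m)} (φ : S → H →L[ℂ] H) : Prop :=
  ∀ (k : ℕ) (s : Fin k → FreeGp m), (∀ i, s i ∈ S) →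
    ∀ (hs : ∀ i j, (s i)⁻¹ * s j ∈ S) (h : Fin k → H),
      0 ≤ ∑ i, ∑ j, ⟪h i, φ ⟨(s i)⁻¹ * s j, hs i j⟩ (h j)⟫_ℂ

/-- `Φ` is a positive definite function on `𝔽` that extends `φ`. -/
def IsPosDefExtension {m : ℕ} {S : Set (FreeGp m)} (φ : S → H →L[ℂ] H)
    (Φ : FreeGp m → H →L[ℂ] H) : Prop :=
  IsPosDef Φ ∧ ∀ s : S, Φ s = φ s

/-! ### Subspaces spanned by families of embeddings -/

section Spans

variable {I : Type*} {K : Type*} [NormedAddCommGroup K] [InnerProductSpace ℂ K]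

/-- The closed linear span of the ranges `ω i H`, `i ∈ J`. -/
def closedSpan (ω : I → H →L[ℂ] K) (J : Set I) : Submodule ℂ K :=
  (⨆ i ∈ J, LinearMap.range (ω i).toLinearMap).topologicalClosure

/-- The orthogonal difference of `closedSpan ω J` and `closedSpan ω J'` (where `J' ⊆ J`). -/
def spanDiff (ω : I → H →L[ℂ] K) (J J' : Set I) : Submodule ℂ K :=
  closedSpan ω J ⊓ (closedSpan ω J')ᗮ

instance spanDiff_hasOrthogonalProjection [CompleteSpace K] (ω : I → H →L[ℂ] K) (J J' : Set I) :
    (spanDiff ω J J').HasOrthogonalProjection := by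
  have hc : IsClosed ((spanDiff ω J J' : Submodule ℂ K) : Set K) := by
    have h1 : IsClosed ((closedSpan ω J : Submodule ℂ K) : Set K) :=
      Submodule.isClosed_topologicalClosure _
    have h2 : IsClosed (((closedSpan ω J')ᗮ : Submodule ℂ K) : Set K) :=
      Submodule.isClosed_orthogonal _
    exact h1.inter h2
  have : CompleteSpace (spanDiff ω J J') := hc.completeSpace_coe
  infer_instance

end Spans

/-! ### Realizations of block operator matrices and the parameter `γ` -/

/-- A realization of the block operator matrix `A = (A i j)` with entries in `L(H)`: a Hilbert
space `R` and operators `ω i : H → R` with `A i j = (ω i)* (ω j)` whose ranges span `R`.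
It exists iff `A` is positive semidefinite, and it is then unique up to a unitary operator. -/
structure Realization {I : Type*} (A : I → I → H →L[ℂ] H)
    (R : Type*) [NormedAddCommGroup R] [InnerProductSpace ℂ R] [CompleteSpace R] where
  ω : I → H →L[ℂ] R
  adjoint_comp : ∀ i j, (ω i).adjoint ∘L ω j = A i j
  span_eq_top : closedSpan ω Set.univ = ⊤

/-- The contraction `γ` attached to the positive block matrix `A` and to two indices `k`, `l`:
it acts from `R(A | I∖{k}) ⊖ R(A | I∖{k,l})` to `R(A | I∖{l}) ⊖ R(A | I∖{k,l})`, and is the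
orthogonal projection onto the latter, restricted to the former. Here `R(A | J)` is realized as
the closed span of the `ω i H`, `i ∈ J`. -/
def Realization.gamma {I : Type*} {A : I → I → H →L[ℂ] H}
    {R : Type*} [NormedAddCommGroup R] [InnerProductSpace ℂ R] [CompleteSpace R]
    (ρ : Realization A R) (k l : I) :
    spanDiff ρ.ω {k}ᶜ {k, l}ᶜ →L[ℂ] spanDiff ρ.ω {l}ᶜ {k, l}ᶜ :=
  (spanDiff ρ.ω {l}ᶜ {k, l}ᶜ).orthogonalProjectionOnto ∘L (spanDiff ρ.ω {k}ᶜ {k, l}ᶜ).subtypeL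

/-- The block operator matrix `A(Φ; C) = [Φ (s⁻¹ t)]`, `s, t ∈ C`. -/
def blockMatrix {m : ℕ} (Φ : FreeGp m → H →L[ℂ] H) (C : Set (FreeGp m)) :
    C → C → H →L[ℂ] H :=
  fun s t => Φ ((s : FreeGp m)⁻¹ * (t : FreeGp m))

/-- The parameter `γ_ν` of `Φ` is zero, where `ν = {r, r⁻¹}`, `r ≤ r⁻¹`. It is computed in the
(essentially unique) realization of `A(Φ; C)`, where `C` is the maximal clique of the graph `Γ_ν`
containing `e` and `r`. -/
def ParameterVanishes {m : ℕ} (o : LinearOrder (FreeGp m)) (Φ : FreeGp m → H →L[ℂ] H)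
    (r : FreeGp m) : Prop :=
  ∃ (C : Set (FreeGp m)) (_ : Maximal (classGraph o r).IsClique C)
    (he : (1 : FreeGp m) ∈ C) (hr : r ∈ C)
    (R : Type u) (_ : NormedAddCommGroup R) (_ : InnerProductSpace ℂ R) (_ : CompleteSpace R)
    (ρ : Realization (blockMatrix Φ C) R),
    ρ.gamma ⟨r, hr⟩ ⟨1, he⟩ = 0

/-- `Φ` is the central extension of `φ : S_n → L(H)` with respect to the lexicographic order `o`:
the positive definite extension of `φ` whose parameters `γ_ν`, for all classes `ν` of words of
length greater than `n`, are zero. -/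
def IsCentralExtension {m n : ℕ} (o : LinearOrder (FreeGp m)) (φ : wordBall m n → H →L[ℂ] H)
    (Φ : FreeGp m → H →L[ℂ] H) : Prop :=
  IsPosDefExtension φ Φ ∧
    ∀ r : FreeGp m, n < r.norm → o.le r r⁻¹ → ParameterVanishes o Φ r

/-! ### Naimark dilations and maximal orthogonality -/

/-- A minimal Naimark dilation of `Φ`: a unitary representation `π` of `𝔽` on a Hilbert space `K`
and an operator `V : H → K` with `Φ s = V* π(s) V`, such that the spaces `π(s) V H` span `K`.
It exists iff `Φ` is positive definite, and it is then unique up to a unitary operator. -/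
structure MinimalNaimarkDilation {m : ℕ} (Φ : FreeGp m → H →L[ℂ] H)
    (K : Type*) [NormedAddCommGroup K] [InnerProductSpace ℂ K] [CompleteSpace K] where
  π : FreeGp m →* (K ≃ₗᵢ[ℂ] K)
  V : H →L[ℂ] K
  dilation : ∀ s, Φ s = V.adjoint ∘L (π s : K →L[ℂ] K) ∘L V
  minimal : closedSpan (fun s => (π s : K →L[ℂ] K) ∘L V) Set.univ = ⊤

/-- The operator `π(s) V`. The space `K_Φ(Σ)` is `closedSpan D.embed Σ`. -/
def MinimalNaimarkDilation.embed {m : ℕ} {Φ : FreeGp m → H →L[ℂ] H}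
    {K : Type*} [NormedAddCommGroup K] [InnerProductSpace ℂ K] [CompleteSpace K]
    (D : MinimalNaimarkDilation Φ K) (s : FreeGp m) : H →L[ℂ] K :=
  (D.π s : K →L[ℂ] K) ∘L D.V

/-- `Φ` is maximal `k + 1` orthogonal: in its (essentially unique) minimal Naimark dilation,
whenever `|s⁻¹ t| = k + 1` and `Σ` is the set of all `r` at distance at most `k` from both `s`
and `t`, the spaces `K_Φ(Σ ∪ {s}) ⊖ K_Φ(Σ)` and `K_Φ(Σ ∪ {t}) ⊖ K_Φ(Σ)` are orthogonal. -/
def IsMaximalOrthogonal {m : ℕ} (k : ℕ) (Φ : FreeGp m → H →L[ℂ] H) : Prop :=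
  ∃ (K : Type u) (_ : NormedAddCommGroup K) (_ : InnerProductSpace ℂ K) (_ : CompleteSpace K)
    (D : MinimalNaimarkDilation Φ K),
    ∀ (s t : FreeGp m), (s⁻¹ * t).norm = k + 1 →
      ∀ S : Set (FreeGp m), S = {r | max (r⁻¹ * s).norm (r⁻¹ * t).norm ≤ k} →
        spanDiff D.embed (S ∪ {s}) S ⟂ spanDiff D.embed (S ∪ {t}) S

end Hilbert

end

/-! ### Hilbert space geometry: closed spans, partial isometries, orthogonality modulo a subspace.
-/

section Hilbert

variable {H : Type u} [NormedAddCommGroup H] [InnerProductSpace ℂ H]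
variable {I : Type*} {K K' : Type*} [NormedAddCommGroup K] [InnerProductSpace ℂ K]
  [NormedAddCommGroup K'] [InnerProductSpace ℂ K']

/-! ### Closed spans -/

/-! The Cayley graph of `𝔽` is a tree, so the word metric satisfies the four point condition. Let
`Q` have diameter `k + 1`, let `a, b ∈ Q` be at distance `k + 1`, and let `B` be the set of points
at distance at most `k` from both. Then every point of `B` is within `k` of all of `Q`, being within
`k` is an equivalence relation on `Q \ B`, and every other pair of `Q` at distance `k + 1` has the
same `B`. So the values on words of length at most `k` fill blocks that overlap only in `B`.
Declaring different blocks orthogonal modulo `B` keeps the matrix positive, since its Schur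
complement over `B` is then block diagonal (`IsProjectionFamily.sum_nonneg`). The value assigned to
`(a, b)` is translation invariant and does not involve `Q`, so this extends the function from `S_k`
to `S_{k+1}` (`IsPosDefUpTo.exists_succ`); iteration gives `Φ`.

Uniqueness rests on `CondOrth.inner_eq`: orthogonality of `a` and `b` modulo `T` determines their
inner products from those involving `T`. For maximal orthogonality, induction on the length
finishes.

For central extensions, shorter words come first, so a clique `C` of `Γ_ν` has diameter at most
`|r|`, and a maximal one containing `e` and `r` contains their `B`. The parameter vanishes iff `e`
and `r` are orthogonal modulo `C \ {e, r}`, which follows from the block structure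
(`condOrth_of_wordDist_le`). Conversely, let all parameters of `Ψ` vanish and let `r` be the least
word of length `k + 1` at which `Ψ` and `Φ` differ. Within `C` they can differ only at the pair of
`e` and `r`, because another pair with the same class would be a nontrivial translate, excluded by
the diameter; so orthogonality forces equality there too (`eq_of_parameterVanishes`). -/

lemma mem_closedSpan (ω : I → H →L[ℂ] K) {J : Set I} {i : I} (hi : i ∈ J) (h : H) :
    ω i h ∈ closedSpan ω J :=
  Submodule.le_topologicalClosure _ <|
    (le_iSup₂_of_le (f := fun i (_ : i ∈ J) => LinearMap.range (ω i).toLinearMap) i hi le_rfl)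
      ⟨h, rfl⟩

lemma closedSpan_le {ω : I → H →L[ℂ] K} {J : Set I} {N : Submodule ℂ K}
    (hN : IsClosed (N : Set K)) (h : ∀ i ∈ J, ∀ x, ω i x ∈ N) : closedSpan ω J ≤ N := by
  refine Submodule.topologicalClosure_minimal _ (iSup₂_le ?_) hN
  rintro i hi _ ⟨x, rfl⟩
  exact h i hi x

lemma isClosed_closedSpan (ω : I → H →L[ℂ] K) (J : Set I) :
    IsClosed (closedSpan ω J : Set K) :=
  Submodule.isClosed_topologicalClosure _

lemma closedSpan_mono (ω : I → H →L[ℂ] K) {J J' : Set I} (h : J ⊆ J') :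
    closedSpan ω J ≤ closedSpan ω J' :=
  closedSpan_le (isClosed_closedSpan _ _) fun _ hi x => mem_closedSpan ω (h hi) x

lemma closedSpan_congr {ω ω' : I → H →L[ℂ] K} {J : Set I} (h : ∀ i ∈ J, ω i = ω' i) :
    closedSpan ω J = closedSpan ω' J :=
  le_antisymm
    (closedSpan_le (isClosed_closedSpan _ _) fun i hi x => h i hi ▸ mem_closedSpan ω' hi x)
    (closedSpan_le (isClosed_closedSpan _ _) fun i hi x => h i hi ▸ mem_closedSpan ω hi x)

lemma closedSpan_image {I' : Type*} (ω : I → H →L[ℂ] K) (f : I' → I) (J : Set I') :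
    closedSpan ω (f '' J) = closedSpan (fun i => ω (f i)) J := by
  refine le_antisymm (closedSpan_le (isClosed_closedSpan _ _) ?_)
    (closedSpan_le (isClosed_closedSpan _ _) fun i hi x =>
      mem_closedSpan ω (Set.mem_image_of_mem f hi) x)
  rintro _ ⟨i, hi, rfl⟩ x
  exact mem_closedSpan (fun i => ω (f i)) hi x

lemma inner_eq_of_mem_closedSpan {ω : I → H →L[ℂ] K} {J : Set I} {p v : K} {B : K →L[ℂ] ℂ}
    (h : ∀ i ∈ J, ∀ x, ⟪v, ω i x⟫_ℂ = B (ω i x)) (hp : p ∈ closedSpan ω J) : ⟪v, p⟫_ℂ = B p := by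
  have : closedSpan ω J ≤ LinearMap.ker (innerSL ℂ v - B).toLinearMap := by
    refine closedSpan_le (ContinuousLinearMap.isClosed_ker _) fun i hi x => ?_
    simp [h i hi x]
  have h2 := this hp
  simpa [sub_eq_zero] using h2

lemma inner_eq_zero_of_mem_closedSpan {ω : I → H →L[ℂ] K} {J : Set I} {p v : K}
    (h : ∀ i ∈ J, ∀ x, ⟪ω i x, v⟫_ℂ = 0) (hp : p ∈ closedSpan ω J) : ⟪p, v⟫_ℂ = 0 := by
  have := inner_eq_of_mem_closedSpan (v := v) (B := 0)
    (fun i hi x => by rw [inner_eq_zero_symm.1 (h i hi x)]; rfl) hp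
  exact inner_eq_zero_symm.1 (by simpa using this)

lemma eq_of_mem_closedSpan {ω : I → H →L[ℂ] K} {J : Set I} {p q : K}
    (hp : p ∈ closedSpan ω J) (hq : q ∈ closedSpan ω J)
    (h : ∀ i ∈ J, ∀ x, ⟪ω i x, p⟫_ℂ = ⟪ω i x, q⟫_ℂ) : p = q := by
  rw [← sub_eq_zero]
  exact inner_self_eq_zero (𝕜 := ℂ).1 (inner_eq_zero_of_mem_closedSpan
    (fun i hi x => by rw [inner_sub_right, h i hi x, sub_self]) (sub_mem hp hq))

lemma exists_projection [CompleteSpace K] (ω : I → H →L[ℂ] K) (J : Set I) (v : K) :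
    ∃ p ∈ closedSpan ω J, ∀ i ∈ J, ∀ x, ⟪ω i x, v - p⟫_ℂ = 0 := by
  have : CompleteSpace (closedSpan ω J) := (isClosed_closedSpan ω J).completeSpace_coe
  refine ⟨(closedSpan ω J).starProjection v, Submodule.starProjection_apply_mem _ _,
    fun i hi x => ?_⟩
  exact (Submodule.sub_starProjection_mem_orthogonal v) _ (mem_closedSpan ω hi x)

/-- `U` is the partial isometry from the span of `ω` to that of `ω'`, zero on the orthogonal
complement. It is built from the closed graph `M ⊆ K ⊕ K'` spanned by the pairs `(ω t h, ω' t h)`,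
on which both coordinate projections have the same Gram form. -/
lemma exists_intertwiner [CompleteSpace K] [CompleteSpace K'] (ω : I → H →L[ℂ] K)
    (ω' : I → H →L[ℂ] K') (T : Set I)
    (hg : ∀ s ∈ T, ∀ t ∈ T, ∀ g h, ⟪ω s g, ω t h⟫_ℂ = ⟪ω' s g, ω' t h⟫_ℂ) :
    ∃ U : K →L[ℂ] K', (∀ t ∈ T, ∀ h, U (ω t h) = ω' t h) ∧ (∀ x, U x ∈ closedSpan ω' T) ∧
      (∀ x, ∀ y ∈ closedSpan ω T, ⟪U x, U y⟫_ℂ = ⟪x, y⟫_ℂ) ∧ ∀ x, ‖U x‖ ≤ ‖x‖ := by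
  let E : (K × K') ≃L[ℂ] WithLp 2 (K × K') := (WithLp.prodContinuousLinearEquiv 2 ℂ K K').symm
  let η : I → H →L[ℂ] WithLp 2 (K × K') := fun t => E.toContinuousLinearMap ∘L (ω t).prod (ω' t)
  let p₁ : WithLp 2 (K × K') →L[ℂ] K :=
    ContinuousLinearMap.fst ℂ K K' ∘L E.symm.toContinuousLinearMap
  let p₂ : WithLp 2 (K × K') →L[ℂ] K' :=
    ContinuousLinearMap.snd ℂ K K' ∘L E.symm.toContinuousLinearMap
  have hin : ∀ x y : WithLp 2 (K × K'), ⟪x, y⟫_ℂ = ⟪p₁ x, p₁ y⟫_ℂ + ⟪p₂ x, p₂ y⟫_ℂ :=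
    fun x y => WithLp.prod_inner_apply _ _
  have h1 : ∀ t h, p₁ (η t h) = ω t h := fun t h => rfl
  have h2 : ∀ t h, p₂ (η t h) = ω' t h := fun t h => rfl
  set M := closedSpan η T with hM
  have : CompleteSpace M := (isClosed_closedSpan η T).completeSpace_coe
  have e1 : ∀ s ∈ T, ∀ g, ∀ y ∈ M, ⟪p₁ (η s g), p₁ y⟫_ℂ = ⟪p₂ (η s g), p₂ y⟫_ℂ := by
    intro s hs g y hy
    have := inner_eq_of_mem_closedSpan (v := p₁.adjoint (p₁ (η s g)))
      (B := innerSL ℂ (p₂ (η s g)) ∘L p₂) (fun t ht h => by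
        rw [ContinuousLinearMap.adjoint_inner_left]
        simpa [h1, h2] using hg s hs t ht g h) hy
    rw [ContinuousLinearMap.adjoint_inner_left] at this
    simpa using this
  let π₁ : M →L[ℂ] K := p₁ ∘L M.subtypeL
  let π₂ : M →L[ℂ] K' := p₂ ∘L M.subtypeL
  let U : K →L[ℂ] K' := (2 : ℂ) • (π₂ ∘L π₁.adjoint)
  have hU1 : ∀ t ∈ T, ∀ h, U (ω t h) = ω' t h := by
    intro t ht h
    -- On `M` each coordinate carries half of the inner product, so `π₁* π₁ = 1/2`; this is the
    -- source of the factor `2`.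
    have key : (2 : ℂ) • π₁.adjoint (ω t h) = ⟨η t h, mem_closedSpan η ht h⟩ := by
      refine ext_inner_right ℂ fun y => ?_
      rw [inner_smul_left, ContinuousLinearMap.adjoint_inner_left, Submodule.coe_inner, hin]
      have := e1 t ht h y y.2
      rw [← this, h1]
      simp only [Complex.conj_ofNat, two_mul]
      rfl
    calc U (ω t h) = π₂ ((2 : ℂ) • π₁.adjoint (ω t h)) := by simp [U]
      _ = ω' t h := by rw [key]; exact h2 t h
  have hU2 : ∀ x, U x ∈ closedSpan ω' T := by
    intro x
    have : M ≤ (closedSpan ω' T).comap p₂.toLinearMap := by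
      refine closedSpan_le ((isClosed_closedSpan ω' T).preimage p₂.continuous) fun t ht h => ?_
      exact mem_closedSpan ω' ht h
    exact Submodule.smul_mem _ _ (this (π₁.adjoint x).2)
  have hU3 : ∀ x, ∀ t ∈ T, ∀ h, ⟪U x, ω' t h⟫_ℂ = ⟪x, ω t h⟫_ℂ := by
    intro x t ht h
    have := e1 t ht h _ (π₁.adjoint x).2
    have h3 : ⟪π₁.adjoint x, ⟨η t h, mem_closedSpan η ht h⟩⟫_ℂ = ⟪x, ω t h⟫_ℂ :=
      ContinuousLinearMap.adjoint_inner_left _ _ _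
    rw [Submodule.coe_inner, hin] at h3
    rw [← inner_conj_symm _ (p₁ (η t h)), this, inner_conj_symm] at h3
    rw [← h3]
    simp only [U, FunLike.coe_smul, Pi.smul_apply, inner_smul_left, Complex.conj_ofNat, two_mul]
    rfl
  have hU4 : ∀ x, ∀ y ∈ closedSpan ω T, ⟪U x, U y⟫_ℂ = ⟪x, y⟫_ℂ := by
    intro x y hy
    symm
    refine inner_eq_of_mem_closedSpan (B := innerSL ℂ (U x) ∘L U) (fun t ht h => ?_) hy
    simp [hU1 t ht, hU3 x t ht]
  refine ⟨U, hU1, hU2, hU4, fun x => ?_⟩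
  obtain ⟨p, hp, hpx⟩ := exists_projection ω T x
  have hUp : U x = U p := by
    refine eq_of_mem_closedSpan (hU2 x) (hU2 p) fun t ht h => ?_
    rw [← inner_conj_symm, ← inner_conj_symm _ (U p), hU3 x t ht, hU3 p t ht, inner_conj_symm,
      inner_conj_symm, ← sub_eq_zero, ← inner_sub_right]
    exact hpx t ht h
  have hn : ‖U x‖ = ‖p‖ := by
    rw [hUp, ← sq_eq_sq₀ (norm_nonneg _) (norm_nonneg _)]
    have := hU4 p p hp
    rw [inner_self_eq_norm_sq_to_K, inner_self_eq_norm_sq_to_K] at this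
    exact_mod_cast this
  have hpp : ⟪p, x⟫_ℂ = ⟪p, p⟫_ℂ := by
    rw [← sub_eq_zero, ← inner_sub_right]
    exact inner_eq_zero_of_mem_closedSpan hpx hp
  have hle : ‖p‖ * ‖p‖ ≤ ‖p‖ * ‖x‖ := by
    have := norm_inner_le_norm (𝕜 := ℂ) p x
    rw [hpp, inner_self_eq_norm_sq_to_K] at this
    simpa [sq] using this
  rw [hn]
  by_cases h0 : ‖p‖ = 0
  · rw [h0]; exact norm_nonneg _
  · exact le_of_mul_le_mul_left hle (lt_of_le_of_ne (norm_nonneg _) (Ne.symm h0))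

/-! ### Conditional orthogonality -/

/-- The vectors `ω a g` and `ω b h` are orthogonal modulo the closed span of the `ω t`, `t ∈ T`. -/
def CondOrth (ω : I → H →L[ℂ] K) (T : Set I) (a b : I) : Prop :=
  ∀ g, ∃ p ∈ closedSpan ω T, (∀ t ∈ T, ∀ h, ⟪ω t h, ω a g - p⟫_ℂ = 0) ∧
    ∀ h, ⟪ω b h, ω a g - p⟫_ℂ = 0

/-- Each difference space is generated by the residuals of the added vectors modulo the span over
`T`. As the residual of `a` is already orthogonal to that span, the residual of `b` may be replaced
by `ω b h` itself. -/
lemma spanDiff_isOrtho_iff [CompleteSpace K] (ω : I → H →L[ℂ] K) (T : Set I) (a b : I) :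
    spanDiff ω (T ∪ {a}) T ⟂ spanDiff ω (T ∪ {b}) T ↔ CondOrth ω T a b := by
  constructor
  · intro hab g
    obtain ⟨p, hp, hpa⟩ := exists_projection ω T (ω a g)
    refine ⟨p, hp, hpa, fun h => ?_⟩
    obtain ⟨q, hq, hqb⟩ := exists_projection ω T (ω b h)
    have mem : ∀ c g p, p ∈ closedSpan ω T → (∀ t ∈ T, ∀ x, ⟪ω t x, ω c g - p⟫_ℂ = 0) →
        ω c g - p ∈ spanDiff ω (T ∪ {c}) T := by
      intro c g p hp hpc
      refine ⟨sub_mem (mem_closedSpan ω (by simp) g)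
        (closedSpan_mono ω Set.subset_union_left hp), ?_⟩
      intro y hy
      exact inner_eq_zero_of_mem_closedSpan hpc hy
    have h1 := Submodule.isOrtho_iff_inner_eq.1 hab.symm _ (mem b h q hq hqb) _ (mem a g p hp hpa)
    rw [inner_sub_left, inner_eq_zero_of_mem_closedSpan hpa hq, sub_zero] at h1
    exact h1
  · intro hab
    rw [Submodule.isOrtho_iff_inner_eq]
    intro y hy x hx
    refine inner_eq_zero_of_mem_closedSpan ?_ hy.1
    rintro t ht g
    rcases ht with ht | rfl
    · exact hx.2 _ (mem_closedSpan ω ht g)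
    · obtain ⟨p, hp, hpt, hpb⟩ := hab g
      have h1 : ⟪x, ω t g - p⟫_ℂ = 0 := by
        refine inner_eq_zero_of_mem_closedSpan ?_ hx.1
        rintro s hs k
        rcases hs with hs | rfl
        · exact hpt s hs k
        · exact hpb k
      have h2 : ⟪p, x⟫_ℂ = 0 := hx.2 _ hp
      have h3 := inner_eq_zero_symm.1 h1
      rwa [inner_sub_left, h2, sub_zero] at h3

/-- Conditional orthogonality is a property of the Gram matrix alone, so it does not depend on the
chosen realization. -/
lemma CondOrth.transfer [CompleteSpace K] [CompleteSpace K'] {ω : I → H →L[ℂ] K}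
    {ω' : I → H →L[ℂ] K'} {T S : Set I} {a b : I} (hT : T ⊆ S) (ha : a ∈ S) (hb : b ∈ S)
    (hg : ∀ s ∈ S, ∀ t ∈ S, ∀ g h, ⟪ω s g, ω t h⟫_ℂ = ⟪ω' s g, ω' t h⟫_ℂ)
    (hab : CondOrth ω T a b) : CondOrth ω' T a b := by
  obtain ⟨U, hU, -, hU', -⟩ := exists_intertwiner ω ω' S hg
  intro g
  obtain ⟨p, hp, hpt, hpb⟩ := hab g
  have hp' : closedSpan ω T ≤ (closedSpan ω' T).comap U.toLinearMap := by
    refine closedSpan_le ((isClosed_closedSpan ω' T).preimage U.continuous) fun t ht h => ?_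
    simpa [hU t (hT ht)] using mem_closedSpan ω' ht h
  have key : ∀ s ∈ S, ∀ h, ⟪ω' s h, ω' a g - U p⟫_ℂ = ⟪ω s h, ω a g - p⟫_ℂ := by
    intro s hs h
    rw [← hU a ha, ← map_sub, ← hU s hs]
    exact hU' _ _ (sub_mem (mem_closedSpan ω ha g) (closedSpan_mono ω hT hp))
  exact ⟨U p, hp' hp, fun t ht h => (key t (hT ht) h).trans (hpt t ht h),
    fun h => (key b hb h).trans (hpb h)⟩

lemma condOrth_of_mem {ω : I → H →L[ℂ] K} {T : Set I} {a : I} (b : I)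
    (ha : ∀ g, ω a g ∈ closedSpan ω T) : CondOrth ω T a b :=
  fun g => ⟨ω a g, ha g, by simp, by simp⟩

/-- Conditional orthogonality determines the inner products of `ω a` and `ω b` from those with the
`ω t`, `t ∈ T`. -/
lemma CondOrth.inner_eq [CompleteSpace K] [CompleteSpace K'] {ω : I → H →L[ℂ] K}
    {ω' : I → H →L[ℂ] K'} {T : Set I} {a b : I} (hab : CondOrth ω T a b)
    (hab' : CondOrth ω' T a b)
    (hg : ∀ t ∈ T, ∀ s, s ∈ T ∨ s = a ∨ s = b → ∀ g h, ⟪ω t g, ω s h⟫_ℂ = ⟪ω' t g, ω' s h⟫_ℂ)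
    (g h : H) : ⟪ω a g, ω b h⟫_ℂ = ⟪ω' a g, ω' b h⟫_ℂ := by
  obtain ⟨U, hU, hU2, hU', -⟩ := exists_intertwiner ω ω' T
    fun s hs t ht => hg s hs t (Or.inl ht)
  obtain ⟨p, hp, hpt, hpb⟩ := hab g
  obtain ⟨p', hp', hpt', hpb'⟩ := hab' g
  simp only [inner_sub_right, sub_eq_zero] at hpt hpb hpt' hpb'
  -- The two projections have the same inner products with the `T`-vectors, so `U` matches them.
  have hUp : U p = p' := by
    refine eq_of_mem_closedSpan (hU2 p) hp' fun t ht x => ?_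
    rw [← hpt' t ht, ← hg t ht a (by simp), hpt t ht, ← hU t ht]
    exact hU' _ _ hp
  have key : ⟪ω b h, p⟫_ℂ = ⟪ω' b h, U p⟫_ℂ := by
    refine inner_eq_of_mem_closedSpan (B := innerSL ℂ (ω' b h) ∘L U) (fun t ht x => ?_) hp
    rw [← inner_conj_symm, hg t ht b (by simp), inner_conj_symm]
    simp [hU t ht]
  rw [← inner_conj_symm, hpb, key, hUp, ← hpb', inner_conj_symm]

end Hilbert

/-! ### The word metric on the free group -/

section WordMetric

open FreeGroup

variable {m : ℕ}

lemma exists_common_prefix {α : Type*} (L M : List α) :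
    ∃ w u v, L = w ++ u ∧ M = w ++ v ∧ ∀ a ∈ u.head?, ∀ b ∈ v.head?, a ≠ b := by
  induction L generalizing M with
  | nil => exact ⟨[], [], M, by simp⟩
  | cons a L ih =>
    cases M with
    | nil => exact ⟨[], a :: L, [], by simp⟩
    | cons b M =>
      by_cases hab : a = b
      · obtain ⟨w, u, v, h1, h2, h3⟩ := ih M
        exact ⟨a :: w, u, v, by simp [h1], by simp [h2, hab], h3⟩
      · exact ⟨[], a :: L, b :: M, by simp, by simp, by simpa using hab⟩

lemma isReduced_invRev_append {u v : List (Fin m × Bool)} (hu : IsReduced u) (hv : IsReduced v)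
    (h : ∀ a ∈ u.head?, ∀ b ∈ v.head?, a ≠ b) : IsReduced (invRev u ++ v) := by
  refine List.isChain_append.2 ⟨?_, hv, ?_⟩
  · change IsReduced (invRev u)
    rw [isReduced_iff_reduce_eq, reduce_invRev, hu.reduce_eq]
  · intro x hx y hy hxy
    simp only [invRev, List.getLast?_reverse, List.head?_map, Option.mem_def,
      Option.map_eq_some_iff] at hx
    obtain ⟨a, ha, rfl⟩ := hx
    have := h a ha y hy
    simp only at hxy ⊢
    by_contra hne
    exact this (Prod.ext hxy (by simpa using hne))

lemma norm_inv_mul_add_le {x z : FreeGp m} {w : List (Fin m × Bool)} (hx : w <+: x.toWord)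
    (hz : w <+: z.toWord) : (x⁻¹ * z).norm + 2 * w.length ≤ x.norm + z.norm := by
  obtain ⟨u, hu⟩ := hx
  obtain ⟨v, hv⟩ := hz
  have hx' : x = mk w * mk u := by rw [mul_mk, hu, mk_toWord]
  have hz' : z = mk w * mk v := by rw [mul_mk, hv, mk_toWord]
  have h1 : x⁻¹ * z = (mk u)⁻¹ * mk v := by rw [hx', hz']; group
  have h2 : x.norm = w.length + u.length := by rw [FreeGroup.norm, ← hu, List.length_append]
  have h3 : z.norm = w.length + v.length := by rw [FreeGroup.norm, ← hv, List.length_append]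
  have h4 := norm_mul_le (mk u)⁻¹ (mk v)
  have h5 : (mk u).norm ≤ _ := norm_mk_le
  have h6 : (mk v).norm ≤ _ := norm_mk_le
  rw [norm_inv_eq] at h4
  rw [h1]
  omega

/-- For the longest common prefix nothing further cancels, so its length is the Gromov product of
`x` and `y` based at `1`. -/
lemma exists_prefix_norm_inv_mul (x y : FreeGp m) :
    ∃ w, w <+: x.toWord ∧ w <+: y.toWord ∧
      (x⁻¹ * y).norm + 2 * w.length = x.norm + y.norm := by
  obtain ⟨w, u, v, hu, hv, h⟩ := exists_common_prefix x.toWord y.toWord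
  refine ⟨w, ⟨u, hu.symm⟩, ⟨v, hv.symm⟩, ?_⟩
  have hur : IsReduced u := (isReduced_toWord (x := x)).infix ⟨w, [], by simp [hu]⟩
  have hvr : IsReduced v := (isReduced_toWord (x := y)).infix ⟨w, [], by simp [hv]⟩
  have hx' : x = mk w * mk u := by rw [mul_mk, ← hu, mk_toWord]
  have hy' : y = mk w * mk v := by rw [mul_mk, ← hv, mk_toWord]
  have h1 : x⁻¹ * y = mk (invRev u ++ v) := by
    rw [← mul_mk, ← inv_mk]
    conv_lhs => rw [hx', hy']
    group
  have h2 : x.norm = w.length + u.length := by rw [FreeGroup.norm, hu, List.length_append]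
  have h3 : y.norm = w.length + v.length := by rw [FreeGroup.norm, hv, List.length_append]
  have h4 : (x⁻¹ * y).norm = u.length + v.length := by
    rw [h1, FreeGroup.norm, toWord_mk, (isReduced_invRev_append hur hvr h).reduce_eq, List.length_append,
      invRev_length]
  omega

/-- The word distance of the free group. -/
def wordDist (s t : FreeGp m) : ℕ := (s⁻¹ * t).norm

lemma wordDist_comm (s t : FreeGp m) : wordDist s t = wordDist t s := by
  rw [wordDist, wordDist, ← norm_inv_eq, mul_inv_rev, inv_inv]

@[simp] lemma wordDist_self (s : FreeGp m) : wordDist s s = 0 := by simp [wordDist]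

lemma wordDist_mul_left (g s t : FreeGp m) : wordDist (g * s) (g * t) = wordDist s t := by
  simp [wordDist, mul_assoc]

@[simp] lemma wordDist_one_left (s : FreeGp m) : wordDist 1 s = s.norm := by simp [wordDist]

/-- This is the ultrametric inequality for Gromov products: of two prefixes of `y` the shorter is a
prefix of the longer, hence common to `x` and `z`. -/
lemma norm_add_wordDist_le (x y z : FreeGp m) :
    wordDist x z + y.norm ≤ max (z.norm + wordDist x y) (x.norm + wordDist y z) := by
  obtain ⟨w, hx, hy, hw⟩ := exists_prefix_norm_inv_mul x y
  obtain ⟨w', hy', hz, hw'⟩ := exists_prefix_norm_inv_mul y z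
  unfold wordDist
  rcases le_total w.length w'.length with hl | hl
  · have := norm_inv_mul_add_le hx ((List.prefix_of_prefix_length_le hy hy' hl).trans hz)
    exact le_max_of_le_left (by omega)
  · have := norm_inv_mul_add_le ((List.prefix_of_prefix_length_le hy' hy hl).trans hx) hz
    exact le_max_of_le_right (by omega)

/-- The four point condition: the Cayley graph of the free group is a tree. -/
lemma wordDist_four_point (x y s t : FreeGp m) :
    wordDist x y + wordDist s t ≤ wordDist x s + wordDist y t ∨
      wordDist x y + wordDist s t ≤ wordDist x t + wordDist y s := by
  have h := norm_add_wordDist_le (s⁻¹ * x) (s⁻¹ * t) (s⁻¹ * y)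
  simp only [wordDist_mul_left] at h
  have e : ∀ z, (s⁻¹ * z).norm = wordDist s z := fun _ => rfl
  rw [e, e, e, wordDist_comm s y, wordDist_comm s x, wordDist_comm t y] at h
  rcases le_max_iff.1 h with h | h <;> omega

/-- Write `x = c y c⁻¹` with `y` cyclically reduced. Then `|x| = 2|c| + |y|` and `|x²| = 2|c| +
2|y|`, so `y` is empty. -/
lemma eq_one_of_norm_mul_self_le {x : FreeGp m} (h : (x * x).norm ≤ x.norm) : x = 1 := by
  have hr : IsReduced x.toWord := isReduced_toWord
  have h1 := reduceCyclically.reduce_flatten_replicate_succ hr 1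
  have h2 := reduceCyclically.conj_conjugator_reduceCyclically x.toWord
  have e : (List.replicate (1 + 1) x.toWord).flatten = x.toWord ++ x.toWord := by
    simp [List.replicate]
  rw [e, ← toWord_mul] at h1
  have l1 : (x * x).norm = _ := congrArg List.length h1
  have l2 := congrArg List.length h2
  simp only [List.length_append, invRev_length, List.length_flatten, List.map_replicate,
    List.sum_replicate, smul_eq_mul] at l1 l2
  have l3 : x.toWord.length = x.norm := rfl
  have h0 : (reduceCyclically x.toWord).length = 0 := by omega
  rw [List.length_eq_zero_iff] at h0
  rw [h0, List.append_nil] at h2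
  rw [← mk_toWord (x := x), ← h2, ← mul_mk, ← inv_mk, mul_inv_cancel]

/-- The elements at distance at most `k` from both `s` and `t`. -/
def ballInter (k : ℕ) (s t : FreeGp m) : Set (FreeGp m) :=
  {r | max (r⁻¹ * s).norm (r⁻¹ * t).norm ≤ k}

lemma mem_ballInter {k : ℕ} {s t r : FreeGp m} :
    r ∈ ballInter k s t ↔ wordDist r s ≤ k ∧ wordDist r t ≤ k := by
  simp only [ballInter, Set.mem_ofPred_eq, max_le_iff, wordDist]

lemma mul_mem_ballInter {k : ℕ} {g s t r : FreeGp m} :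
    g * r ∈ ballInter k (g * s) (g * t) ↔ r ∈ ballInter k s t := by
  simp only [mem_ballInter, wordDist_mul_left]

/-- By the four point condition, `d(x,y) + (k + 1)` is at most `k + (k + 1)`. -/
lemma wordDist_le_of_mem_ballInter {k : ℕ} {s t x y : FreeGp m} (hst : wordDist s t = k + 1)
    (hx : x ∈ ballInter k s t) (hys : wordDist y s ≤ k + 1) (hyt : wordDist y t ≤ k + 1) :
    wordDist x y ≤ k := by
  rw [mem_ballInter] at hx
  rcases wordDist_four_point x y s t with h | h <;> omega

/-- A point `y` outside the intersection is at distance at least `k + 1` from `s` or `t`; the four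
point condition with that endpoint gives the bound. This makes being within `k` an equivalence
relation off the intersection. -/
lemma wordDist_trans_of_not_mem_ballInter {k : ℕ} {s t x y z : FreeGp m}
    (hy : y ∉ ballInter k s t) (hxs : wordDist x s ≤ k + 1) (hxt : wordDist x t ≤ k + 1)
    (hzs : wordDist z s ≤ k + 1) (hzt : wordDist z t ≤ k + 1)
    (hxy : wordDist x y ≤ k) (hyz : wordDist y z ≤ k) : wordDist x z ≤ k := by
  rw [mem_ballInter, not_and_or] at hy
  rw [wordDist_comm y z] at hyz
  rcases hy with hy | hy
  · rcases wordDist_four_point x z y s with h | h <;> omega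
  · rcases wordDist_four_point x z y t with h | h <;> omega

/-- All diametral pairs of a set of diameter `k + 1` thus share one separating set, modulo which
every such pair can be treated at once. -/
lemma ballInter_eq {k : ℕ} {s t a b : FreeGp m} (hst : wordDist s t = k + 1)
    (hab : wordDist a b = k + 1) (has : wordDist a s ≤ k + 1) (hat : wordDist a t ≤ k + 1)
    (hbs : wordDist b s ≤ k + 1) (hbt : wordDist b t ≤ k + 1) :
    ballInter k a b = ballInter k s t := by
  ext x
  constructor
  · intro hx
    rw [mem_ballInter]
    rw [wordDist_comm] at has hat hbs hbt
    exact ⟨wordDist_le_of_mem_ballInter hab hx has hbs, wordDist_le_of_mem_ballInter hab hx hat hbt⟩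
  · intro hx
    rw [mem_ballInter]
    exact ⟨wordDist_le_of_mem_ballInter hst hx has hat, wordDist_le_of_mem_ballInter hst hx hbs hbt⟩

/-- A nontrivial translate of a pair of points at distance `N` is not contained, together with the
pair, in a set of diameter `N`. -/
lemma eq_one_of_wordDist_le {r x : FreeGp m} (h1 : wordDist 1 (x * r) ≤ r.norm)
    (h2 : wordDist x r ≤ r.norm) : x = 1 := by
  apply eq_one_of_norm_mul_self_le
  -- Since `d(x, xr) = |r|`, either alternative yields `|x²| ≤ |x|`.
  have h := wordDist_four_point 1 (x * x) x (x * r)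
  have e0 : wordDist x (x * r) = r.norm := by simp [wordDist]
  have e1 : wordDist (x * x) (x * r) = wordDist x r := wordDist_mul_left _ _ _
  have e2 : wordDist (x * x) x = x.norm := by
    rw [wordDist_comm]; simp [wordDist]
  rw [e0, e1, e2, wordDist_one_left, wordDist_one_left] at h
  rw [wordDist_one_left] at h1 h
  omega

lemma finite_setOf_norm_eq (N : ℕ) : {s : FreeGp m | s.norm = N}.Finite :=
  Set.Finite.of_finite_image ((List.finite_length_eq (Fin m × Bool) N).subset
    (by rintro _ ⟨s, hs, rfl⟩; exact hs)) toWord_injective.injOn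

end WordMetric

section Kernels

lemma inner_self_eq_ofReal_norm_sq {K : Type*} [NormedAddCommGroup K] [InnerProductSpace ℂ K]
    (x : K) : ⟪x, x⟫_ℂ = ((‖x‖ ^ 2 : ℝ) : ℂ) := by
  rw [inner_self_eq_norm_sq_to_K]
  simp

variable {H : Type u} [NormedAddCommGroup H] [InnerProductSpace ℂ H]

/-! ### Positive kernels and their realizations -/

/-- Polarization: single vectors make the diagonal forms real, pairs `(x, y)` and `(x, i y)` then
compare imaginary and real parts. -/
lemma adjoint_eq_of_forall_nonneg [CompleteSpace H] {I : Type*} {A : I → I → H →L[ℂ] H}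
    (hA : ∀ (k : ℕ) (s : Fin k → I) (h : Fin k → H), 0 ≤ ∑ i, ∑ j, ⟪h i, A (s i) (s j) (h j)⟫_ℂ)
    (i j : I) : (A i j).adjoint = A j i := by
  have im1 : ∀ i x, (⟪x, A i i x⟫_ℂ).im = 0 := fun i x => by
    have := (Complex.le_def.1 (hA 1 (fun _ => i) (fun _ => x))).2
    simpa using this.symm
  have im2 : ∀ x y, (⟪x, A i j y⟫_ℂ + ⟪y, A j i x⟫_ℂ).im = 0 := fun x y => by
    have := (Complex.le_def.1 (hA 2 ![i, j] ![x, y])).2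
    simp only [Fin.sum_univ_two, Matrix.cons_val_zero, Matrix.cons_val_one, Complex.add_im,
      Complex.zero_im, im1] at this
    rw [Complex.add_im]
    linarith
  ext x
  refine ext_inner_left ℂ fun y => ?_
  rw [ContinuousLinearMap.adjoint_inner_right, ← inner_conj_symm]
  have h1 := im2 x y
  have h2 := im2 x (Complex.I • y)
  rw [map_smul, inner_smul_right, inner_smul_left] at h2
  simp only [Complex.add_im, Complex.mul_im, Complex.conj_I, Complex.neg_re, Complex.neg_im,
    Complex.I_re, Complex.I_im] at h1 h2
  apply Complex.ext
  · rw [Complex.conj_re]; linarith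
  · rw [Complex.conj_im]; linarith

/-- The realization is the reproducing kernel Hilbert space of `A`, with the kernel functions as
`ω`. -/
theorem nonempty_realization [CompleteSpace H] {I : Type} {A : I → I → H →L[ℂ] H}
    (hA : ∀ (k : ℕ) (s : Fin k → I) (h : Fin k → H), 0 ≤ ∑ i, ∑ j, ⟪h i, A (s i) (s j) (h j)⟫_ℂ) :
    ∃ (R : Type u) (_ : NormedAddCommGroup R) (_ : InnerProductSpace ℂ R) (_ : CompleteSpace R),
      Nonempty (Realization A R) := by
  have hpos : (Matrix.of A).PosSemidef := by
    have htfae := (RKHS.posSemidef_tfae (K := Matrix.of A)).out 0 2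
    refine htfae.2 (And.intro ?_ fun v => ?_)
    · ext1 i j
      exact adjoint_eq_of_forall_nonneg hA j i
    · have e := v.support.equivFin.symm
      have := (Complex.le_def.1 (hA _ (fun i => (e i : I)) (fun i => v (e i)))).1
      rw [Complex.zero_re] at this
      refine this.trans_eq (congrArg Complex.re ?_)
      have hsum : ∀ F : I → ℂ, ∑ i, F (e i) = ∑ a ∈ v.support, F a := fun F =>
        (e.sum_comp fun a : v.support => F a).trans (Finset.sum_coe_sort _ F)
      simp only [Finsupp.sum, Matrix.of_apply]
      rw [hsum fun a => ∑ j, ⟪v a, A a (e j) (v (e j))⟫_ℂ]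
      simp_rw [fun a => hsum fun b => ⟪v a, A a b (v b)⟫_ℂ]
      refine Finset.sum_congr rfl fun i _ => Finset.sum_congr rfl fun j _ => ?_
      rw [← ContinuousLinearMap.adjoint_inner_left, adjoint_eq_of_forall_nonneg hA]
  have : Fact (Matrix.of A).PosSemidef := ⟨hpos⟩
  refine ⟨RKHS.OfKernel (Matrix.of A), inferInstance, inferInstance, inferInstance,
    ⟨⟨RKHS.kerFun _, fun i j => ?_, ?_⟩⟩⟩
  · rw [← RKHS.kernel_apply, RKHS.OfKernel.kernel_ofKernel, Matrix.of_apply]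
  · rw [eq_top_iff, ← RKHS.kerFun_dense (RKHS.OfKernel (Matrix.of A))]
    refine Submodule.topologicalClosure_mono (Submodule.span_le.2 ?_)
    rintro _ ⟨x, v, rfl⟩
    exact (le_iSup₂_of_le (f := fun i (_ : i ∈ Set.univ) =>
      LinearMap.range (RKHS.kerFun (RKHS.OfKernel (Matrix.of A)) i).toLinearMap) x trivial le_rfl)
      ⟨v, rfl⟩

variable {I : Type*} {K : Type*} [NormedAddCommGroup K] [InnerProductSpace ℂ K]

/-- The Gram matrix of the family `ω`, restricted to `S`, is the kernel `A`. -/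
def IsGramOn (ω : I → H →L[ℂ] K) (A : I → I → H →L[ℂ] H) (S : Set I) : Prop :=
  ∀ s ∈ S, ∀ t ∈ S, ∀ g h, ⟪ω s g, ω t h⟫_ℂ = ⟪g, A s t h⟫_ℂ

/-- The kernel `A` is the Gram matrix, on `S`, of a family of operators. -/
def HasRealizationOn (A : I → I → H →L[ℂ] H) (S : Set I) : Prop :=
  ∃ (R : Type u) (_ : NormedAddCommGroup R) (_ : InnerProductSpace ℂ R) (_ : CompleteSpace R)
    (ω : I → H →L[ℂ] R), IsGramOn ω A S

lemma Realization.inner_eq [CompleteSpace H] {A : I → I → H →L[ℂ] H} [CompleteSpace K] (ρ : Realization A K)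
    (s t : I) (g h : H) : ⟪ρ.ω s g, ρ.ω t h⟫_ℂ = ⟪g, A s t h⟫_ℂ := by
  rw [← ρ.adjoint_comp s t, ContinuousLinearMap.comp_apply,
    ContinuousLinearMap.adjoint_inner_right]

/-- A family `ω` of operators that represents the orthogonal projections, to the closed span of the
`t`-th ranges, `t ∈ T`, of a realization of `A`. -/
structure IsProjectionFamily (ω : I → H →L[ℂ] K) (A : I → I → H →L[ℂ] H) (T Q : Set I) :
    Prop where
  inner_eq : ∀ t ∈ T, ∀ s ∈ T ∪ Q, ∀ g h, ⟪ω t g, ω s h⟫_ℂ = ⟪g, A t s h⟫_ℂ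
  mem : ∀ s ∈ T ∪ Q, ∀ h, ω s h ∈ closedSpan ω T

/-- Projecting `s` to the span over `T` involves only the entries on `T ∪ {s}`, so no positivity on
pairs of points of `Q` is needed. Intertwiners carry all these projections into one space. -/
theorem exists_isProjectionFamily {A : I → I → H →L[ℂ] H} {T Q : Set I}
    (hT : HasRealizationOn A T)
    (hQ : ∀ s ∈ Q, HasRealizationOn A (insert s T)) :
    ∃ (R : Type u) (_ : NormedAddCommGroup R) (_ : InnerProductSpace ℂ R)
      (_ : CompleteSpace R) (ω : I → H →L[ℂ] R), IsProjectionFamily ω A T Q := by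
  classical
  obtain ⟨R, _, _, _, ω, hω⟩ := hT
  have key : ∀ s ∈ Q, ∃ β : H →L[ℂ] R, (∀ h, β h ∈ closedSpan ω T) ∧
      ∀ t ∈ T, ∀ g h, ⟪ω t g, β h⟫_ℂ = ⟪g, A t s h⟫_ℂ := by
    intro s hs
    obtain ⟨R', _, _, _, ω', hω'⟩ := hQ s hs
    obtain ⟨U, hU, hU2, hU3, -⟩ := exists_intertwiner ω' ω T fun a ha b hb g h => by
      rw [hω a ha b hb, hω' a (by simp [ha]) b (by simp [hb])]
    refine ⟨U ∘L ω' s, fun h => hU2 _, fun t ht g h => ?_⟩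
    rw [← hω' t (by simp [ht]) s (by simp), ← hU t ht, ← inner_conj_symm,
      ContinuousLinearMap.comp_apply, hU3 _ _ (mem_closedSpan ω' ht g), inner_conj_symm]
  choose! β hβ1 hβ2 using key
  let ω₁ : I → H →L[ℂ] R := fun s => if s ∈ T then ω s else β s
  have e1 : ∀ t ∈ T, ω₁ t = ω t := fun t ht => if_pos ht
  have e2 : ∀ t ∉ T, ω₁ t = β t := fun t ht => if_neg ht
  refine ⟨R, inferInstance, inferInstance, inferInstance, ω₁, fun t ht s hs g h => ?_, fun s hs h => ?_⟩
  · by_cases hsT : s ∈ T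
    · rw [e1 t ht, e1 s hsT, hω t ht s hsT]
    · rw [e1 t ht, e2 s hsT, hβ2 s (hs.resolve_left hsT) t ht]
  · rw [closedSpan_congr e1]
    by_cases hsT : s ∈ T
    · rw [e1 s hsT]
      exact mem_closedSpan ω hsT h
    · rw [e2 s hsT]
      exact hβ1 s (hs.resolve_left hsT) h

/-- The Schur complement of a positive kernel is positive. -/
lemma IsProjectionFamily.schur_nonneg [CompleteSpace K] {ω : I → H →L[ℂ] K}
    {A : I → I → H →L[ℂ] H} {T Q : Set I} (hω : IsProjectionFamily ω A T Q) {R : Type*}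
    [NormedAddCommGroup R] [InnerProductSpace ℂ R] [CompleteSpace R] {ω' : I → H →L[ℂ] R}
    (hω' : IsGramOn ω' A (T ∪ Q)) {ι : Type*} (c : Finset ι) (s : ι → I)
    (hs : ∀ i ∈ c, s i ∈ T ∪ Q) (h : ι → H) :
    0 ≤ ∑ i ∈ c, ∑ j ∈ c, (⟪h i, A (s i) (s j) (h j)⟫_ℂ - ⟪ω (s i) (h i), ω (s j) (h j)⟫_ℂ) := by
  obtain ⟨U, hU, hU2, hU3, hU4⟩ := exists_intertwiner ω' ω T fun a ha b hb g h => by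
    rw [hω.inner_eq a ha b (by simp [hb]), hω' a (by simp [ha]) b (by simp [hb])]
  -- `U` acts as the projection to the span over `T`; its contractivity is the asserted inequality.
  have hUs : ∀ s ∈ T ∪ Q, ∀ x, U (ω' s x) = ω s x := by
    intro s hs x
    refine eq_of_mem_closedSpan (hU2 _) (hω.mem s hs x) fun t ht g => ?_
    rw [hω.inner_eq t ht s hs, ← hω' t (by simp [ht]) s hs, ← inner_conj_symm, ← hU t ht,
      hU3 _ _ (mem_closedSpan ω' ht g), inner_conj_symm]
  have hle := hU4 (∑ i ∈ c, ω' (s i) (h i))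
  rw [map_sum, Finset.sum_congr rfl fun i hi => hUs (s i) (hs i hi) (h i)] at hle
  have e1 : ∑ i ∈ c, ∑ j ∈ c, ⟪h i, A (s i) (s j) (h j)⟫_ℂ =
      ((‖∑ i ∈ c, ω' (s i) (h i)‖ ^ 2 : ℝ) : ℂ) := by
    rw [← inner_self_eq_ofReal_norm_sq, sum_inner]
    refine Finset.sum_congr rfl fun i hi => ?_
    rw [inner_sum]
    exact Finset.sum_congr rfl fun j hj => (hω' _ (hs i hi) _ (hs j hj) _ _).symm
  have e2 : ∑ i ∈ c, ∑ j ∈ c, ⟪ω (s i) (h i), ω (s j) (h j)⟫_ℂ =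
      ((‖∑ i ∈ c, ω (s i) (h i)‖ ^ 2 : ℝ) : ℂ) := by
    rw [← inner_self_eq_ofReal_norm_sq, sum_inner]
    exact Finset.sum_congr rfl fun i hi => inner_sum _ _ _ |>.symm
  simp_rw [Finset.sum_sub_distrib]
  rw [e1, e2, ← Complex.ofReal_sub, Complex.zero_le_real]
  exact sub_nonneg.2 (pow_le_pow_left₀ (norm_nonneg _) hle 2)

/-- Gluing of positive kernels: if the index set of `A` is partitioned, modulo `T`, by `cls`, and
`A` is positive on `T` together with each class, and different classes are orthogonal modulo `T`,
then `A` is positive. -/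
lemma IsProjectionFamily.sum_nonneg [CompleteSpace K] {ω : I → H →L[ℂ] K}
    {A : I → I → H →L[ℂ] H} {T Q : Set I} (hω : IsProjectionFamily ω A T Q) {C : Type*}
    (cls : I → C)
    (hreal : ∀ c, HasRealizationOn A (T ∪ {s ∈ Q | cls s = c}))
    (hcross : ∀ s ∈ Q, ∀ t ∈ Q, cls s ≠ cls t → ∀ g h, ⟪g, A s t h⟫_ℂ = ⟪ω s g, ω t h⟫_ℂ)
    {k : ℕ} (s : Fin k → I) (hs : ∀ i, s i ∈ Q) (h : Fin k → H) :
    0 ≤ ∑ i, ∑ j, ⟪h i, A (s i) (s j) (h j)⟫_ℂ := by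
  classical
  -- The form is the Gram form of the projections plus the Schur complement, which has no entries
  -- between different classes and so splits into one nonnegative sum per class.
  have e : ∑ i, ∑ j, ⟪h i, A (s i) (s j) (h j)⟫_ℂ =
      ⟪∑ i, ω (s i) (h i), ∑ i, ω (s i) (h i)⟫_ℂ +
        ∑ i, ∑ j, (⟪h i, A (s i) (s j) (h j)⟫_ℂ - ⟪ω (s i) (h i), ω (s j) (h j)⟫_ℂ) := by
    simp_rw [Finset.sum_sub_distrib, sum_inner, inner_sum]
    ring
  rw [e]
  refine add_nonneg ?_ ?_
  · rw [inner_self_eq_ofReal_norm_sq]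
    exact Complex.zero_le_real.2 (sq_nonneg _)
  rw [← Finset.sum_fiberwise_of_maps_to (s := Finset.univ) (g := fun i => cls (s i))
    (t := Finset.univ.image fun i => cls (s i)) fun i _ => Finset.mem_image_of_mem _ (by simp)]
  refine Finset.sum_nonneg fun c _ => ?_
  obtain ⟨R, _, _, _, ω', hω'⟩ := hreal c
  have hsub : T ∪ {s ∈ Q | cls s = c} ⊆ T ∪ Q :=
    Set.union_subset_union_right T fun _ hx => hx.1
  have hω₁ : IsProjectionFamily ω A T {s ∈ Q | cls s = c} :=
    ⟨fun t ht s hs => hω.inner_eq t ht s (hsub hs), fun s hs => hω.mem s (hsub hs)⟩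
  refine (hω₁.schur_nonneg hω' (Finset.univ.filter fun i => cls (s i) = c) s
    (fun i hi => Or.inr ⟨hs i, by simpa using hi⟩) h).trans_eq ?_
  refine Finset.sum_congr rfl fun i hi => Finset.sum_subset (Finset.subset_univ _) fun j _ hj => ?_
  simp only [Finset.mem_filter, Finset.mem_univ, true_and] at hi hj
  rw [hcross _ (hs i) _ (hs j) (fun h' => hj (h' ▸ hi)), sub_self]

/-- If the family `ω` realizes the entries `A a b` as inner products of projections to the closed
span of the `ω t`, `t ∈ T`, then `ω a` and `ω b` are orthogonal modulo this span. -/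
lemma IsProjectionFamily.condOrth [CompleteSpace K] {A : I → I → H →L[ℂ] H} {T : Set I} {a b : I}
    {ω' : I → H →L[ℂ] K} (hω' : IsProjectionFamily ω' A T {a, b}) {R : Type*}
    [NormedAddCommGroup R] [InnerProductSpace ℂ R] [CompleteSpace R] {ω : I → H →L[ℂ] R}
    (hω : ∀ t ∈ T, ∀ s ∈ T ∪ {a, b}, ∀ g h, ⟪ω t g, ω s h⟫_ℂ = ⟪g, A t s h⟫_ℂ)
    (hab : ∀ g h, ⟪ω a g, ω b h⟫_ℂ = ⟪ω' a g, ω' b h⟫_ℂ) : CondOrth ω T a b := by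
  obtain ⟨U, hU, hU2, hU3, -⟩ := exists_intertwiner ω' ω T fun s hs t ht g h => by
    rw [hω s hs t (by simp [ht]), hω'.inner_eq s hs t (by simp [ht])]
  intro g
  refine ⟨U (ω' a g), hU2 _, fun t ht h => ?_, fun h => ?_⟩
  · rw [inner_sub_right, sub_eq_zero, hω t ht a (by simp), ← hω'.inner_eq t ht a (by simp),
      ← hU t ht, hU3 _ _ (hω'.mem a (by simp) g)]
  · have key : ⟪ω' b h, ω' a g⟫_ℂ = ⟪ω b h, U (ω' a g)⟫_ℂ := by
      refine inner_eq_of_mem_closedSpan (B := innerSL ℂ (ω b h) ∘L U) (fun t ht x => ?_)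
        (hω'.mem a (by simp) g)
      rw [← inner_conj_symm, hω'.inner_eq t ht b (by simp), ← hω t ht b (by simp),
        inner_conj_symm]
      simp [hU t ht]
    rw [inner_sub_right, ← key, ← inner_conj_symm, hab, inner_conj_symm, sub_self]

end Kernels

section Extension

variable {m : ℕ} {H : Type u} [NormedAddCommGroup H] [InnerProductSpace ℂ H]

/-! ### Extension by one more length -/

/-- The kernel `(s, t) ↦ Φ (s⁻¹ t)`. -/
def groupKernel (Φ : FreeGp m → H →L[ℂ] H) : FreeGp m → FreeGp m → H →L[ℂ] H :=
  fun s t => Φ (s⁻¹ * t)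

/-- `Φ` restricts to a positive definite function on the words of length at most `k`. -/
def IsPosDefUpTo (k : ℕ) (Φ : FreeGp m → H →L[ℂ] H) : Prop :=
  ∀ (K : ℕ) (s : Fin K → FreeGp m), (∀ i j, wordDist (s i) (s j) ≤ k) → ∀ h : Fin K → H,
    0 ≤ ∑ i, ∑ j, ⟪h i, Φ ((s i)⁻¹ * s j) (h j)⟫_ℂ

lemma IsPosDefUpTo.congr {k : ℕ} {Φ Ψ : FreeGp m → H →L[ℂ] H} (hΦ : IsPosDefUpTo k Φ)
    (h : ∀ s : FreeGp m, s.norm ≤ k → Ψ s = Φ s) : IsPosDefUpTo k Ψ := by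
  intro K s hs x
  refine (hΦ K s hs x).trans_eq (Finset.sum_congr rfl fun i _ => Finset.sum_congr rfl fun j _ => ?_)
  rw [h _ (hs i j)]

lemma IsPosDefUpTo.hasRealizationOn [CompleteSpace H] {k : ℕ} {Φ : FreeGp m → H →L[ℂ] H}
    (hΦ : IsPosDefUpTo k Φ) {Q : Set (FreeGp m)} (hQ : ∀ s ∈ Q, ∀ t ∈ Q, wordDist s t ≤ k) :
    HasRealizationOn (groupKernel Φ) Q := by
  classical
  obtain ⟨R, _, _, _, ⟨ρ⟩⟩ := nonempty_realization (A := blockMatrix Φ Q)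
    fun K s h => hΦ K (fun i => s i) (fun i j => hQ _ (s i).2 _ (s j).2) h
  refine ⟨R, inferInstance, inferInstance, inferInstance,
    fun s => if hs : s ∈ Q then ρ.ω ⟨s, hs⟩ else 0, fun s hs t ht g h => ?_⟩
  simp only [dif_pos hs, dif_pos ht, ρ.inner_eq]
  rfl

/-- `X` is the value at `a⁻¹ b` that makes `a` and `b` orthogonal modulo the elements at distance
at most `k` from both. -/
def IsOrthogonalValue (Φ : FreeGp m → H →L[ℂ] H) (k : ℕ) (a b : FreeGp m) (X : H →L[ℂ] H) :
    Prop :=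
  ∃ (R : Type u) (_ : NormedAddCommGroup R) (_ : InnerProductSpace ℂ R) (_ : CompleteSpace R)
    (ω : FreeGp m → H →L[ℂ] R),
    IsProjectionFamily ω (groupKernel Φ) (ballInter k a b) {a, b} ∧
      ∀ g h, ⟪ω a g, ω b h⟫_ℂ = ⟪g, X h⟫_ℂ

/-- The separating set has diameter at most `k` and lies within `k` of each point of `Q`, so
positivity up to length `k` suffices. -/
lemma exists_isProjectionFamily_ballInter [CompleteSpace H] {Φ : FreeGp m → H →L[ℂ] H} {k : ℕ}
    (hΦ : IsPosDefUpTo k Φ) {a b : FreeGp m} (hab : wordDist a b = k + 1) (Q : Set (FreeGp m))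
    (hQ : ∀ s ∈ Q, wordDist s a ≤ k + 1 ∧ wordDist s b ≤ k + 1) :
    ∃ (R : Type u) (_ : NormedAddCommGroup R) (_ : InnerProductSpace ℂ R) (_ : CompleteSpace R)
      (ω : FreeGp m → H →L[ℂ] R), IsProjectionFamily ω (groupKernel Φ) (ballInter k a b) Q := by
  have hB : ∀ s ∈ ballInter k a b, ∀ t ∈ ballInter k a b, wordDist s t ≤ k := by
    intro s hs t ht
    have h := mem_ballInter.1 ht
    exact wordDist_le_of_mem_ballInter hab hs (by omega) (by omega)
  refine exists_isProjectionFamily (hΦ.hasRealizationOn hB) fun s hs => hΦ.hasRealizationOn ?_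
  have hsB : ∀ t ∈ ballInter k a b, wordDist t s ≤ k := fun t ht =>
    wordDist_le_of_mem_ballInter hab ht (hQ s hs).1 (hQ s hs).2
  rintro x (rfl | hx) y (rfl | hy)
  · simp
  · exact wordDist_comm x y ▸ hsB y hy
  · exact hsB x hx
  · exact hB x hx y hy

lemma exists_isOrthogonalValue [CompleteSpace H] {Φ : FreeGp m → H →L[ℂ] H} {k : ℕ}
    (hΦ : IsPosDefUpTo k Φ) {a b : FreeGp m} (hab : wordDist a b = k + 1) :
    ∃ X, IsOrthogonalValue Φ k a b X := by
  obtain ⟨R, _, _, _, ω, hω⟩ := exists_isProjectionFamily_ballInter hΦ hab {a, b} (by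
    rintro s (rfl | rfl)
    · simp [hab]
    · rw [wordDist_comm] at hab; simp [hab])
  refine ⟨(ω a).adjoint ∘L ω b, R, _, _, ‹_›, ω, hω, fun g h => ?_⟩
  rw [ContinuousLinearMap.comp_apply, ContinuousLinearMap.adjoint_inner_right]

/-- Left invariance lets the orthogonal value be a function of `a⁻¹ b`. -/
lemma IsOrthogonalValue.translate {Φ : FreeGp m → H →L[ℂ] H} {k : ℕ} {a b : FreeGp m}
    {X : H →L[ℂ] H} (hX : IsOrthogonalValue Φ k a b X) (g : FreeGp m) :
    IsOrthogonalValue Φ k (g * a) (g * b) X := by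
  obtain ⟨R, _, _, _, ω, hω, hab⟩ := hX
  have hB : ∀ t, t ∈ ballInter k (g * a) (g * b) → g⁻¹ * t ∈ ballInter k a b := fun t ht => by
    rwa [← mul_mem_ballInter (g := g), mul_inv_cancel_left]
  have hs' : ∀ s, s ∈ ballInter k (g * a) (g * b) ∪ {g * a, g * b} →
      g⁻¹ * s ∈ ballInter k a b ∪ {a, b} := by
    rintro s (hs | rfl | rfl)
    · exact Or.inl (hB s hs)
    · simp
    · simp
  refine ⟨R, _, _, ‹_›, fun s => ω (g⁻¹ * s), ⟨fun t ht s hs x y => ?_, fun s hs x => ?_⟩,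
    fun x y => by simpa using hab x y⟩
  · have := hω.inner_eq _ (hB t ht) _ (hs' s hs) x y
    simpa [groupKernel, mul_assoc] using this
  · have h1 : closedSpan ω (ballInter k a b) ≤
        closedSpan (fun s => ω (g⁻¹ * s)) (ballInter k (g * a) (g * b)) := by
      refine closedSpan_le (isClosed_closedSpan _ _) fun t ht y => ?_
      have := mem_closedSpan (fun s => ω (g⁻¹ * s)) (mul_mem_ballInter (g := g).2 ht) y
      simpa using this
    exact h1 (hω.mem _ (hs' s hs) x)

/-- The orthogonal value sees only words of length at most `k`. -/
lemma IsOrthogonalValue.congr {Φ Ψ : FreeGp m → H →L[ℂ] H} {k : ℕ} {a b : FreeGp m}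
    {X : H →L[ℂ] H} (hX : IsOrthogonalValue Φ k a b X) (hab : wordDist a b = k + 1)
    (h : ∀ s : FreeGp m, s.norm ≤ k → Ψ s = Φ s) : IsOrthogonalValue Ψ k a b X := by
  obtain ⟨R, _, _, _, ω, hω, hX⟩ := hX
  refine ⟨R, _, _, ‹_›, ω, ⟨fun t ht s hs x y => ?_, hω.mem⟩, hX⟩
  have hts : wordDist t s ≤ k := by
    rcases hs with hs | rfl | rfl
    · have h := mem_ballInter.1 hs
      exact wordDist_le_of_mem_ballInter hab ht (by omega) (by omega)
    · exact (mem_ballInter.1 ht).1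
    · exact (mem_ballInter.1 ht).2
  rw [hω.inner_eq t ht s hs, groupKernel, groupKernel, h _ hts]

lemma IsOrthogonalValue.inner_eq {Φ : FreeGp m → H →L[ℂ] H} {k : ℕ} {a b : FreeGp m}
    {X : H →L[ℂ] H} (hX : IsOrthogonalValue Φ k a b X) {K : Type*} [NormedAddCommGroup K]
    [InnerProductSpace ℂ K] [CompleteSpace K] {ω : FreeGp m → H →L[ℂ] K}
    (hω : CondOrth ω (ballInter k a b) a b)
    (hgram : ∀ t ∈ ballInter k a b, ∀ s ∈ ballInter k a b ∪ {a, b}, ∀ g h,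
      ⟪ω t g, ω s h⟫_ℂ = ⟪g, groupKernel Φ t s h⟫_ℂ) (g h : H) :
    ⟪ω a g, ω b h⟫_ℂ = ⟪g, X h⟫_ℂ := by
  obtain ⟨R, _, _, _, ω', hω', hX⟩ := hX
  rw [← hX]
  refine hω.inner_eq (condOrth_of_mem b (hω'.mem a (by simp))) (fun t ht s hs x y => ?_) g h
  have hs' : s ∈ ballInter k a b ∪ {a, b} := by
    rcases hs with hs | rfl | rfl <;> simp [*]
  rw [hgram t ht s hs', hω'.inner_eq t ht s hs']

lemma IsOrthogonalValue.condOrth {Φ : FreeGp m → H →L[ℂ] H} {k : ℕ} {a b : FreeGp m}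
    (hab : IsOrthogonalValue Φ k a b (Φ (a⁻¹ * b))) {K : Type*} [NormedAddCommGroup K]
    [InnerProductSpace ℂ K] [CompleteSpace K] {ω : FreeGp m → H →L[ℂ] K}
    (hω : IsGramOn ω (groupKernel Φ) Set.univ) : CondOrth ω (ballInter k a b) a b := by
  obtain ⟨R, _, _, _, ω', hω', h⟩ := hab
  refine hω'.condOrth (fun t _ s _ => hω t trivial s trivial) fun x y => ?_
  rw [h, hω a trivial b trivial, groupKernel]

/-- A positive definite function on `S_k` extends to `S_{k+1}`, with all pairs of elements at
distance `k + 1` orthogonal modulo the elements at distance at most `k` from both. -/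
theorem IsPosDefUpTo.exists_succ [CompleteSpace H] {k : ℕ} {φ : FreeGp m → H →L[ℂ] H}
    (hφ : IsPosDefUpTo k φ) :
    ∃ Φ : FreeGp m → H →L[ℂ] H, (∀ s : FreeGp m, s.norm ≤ k → Φ s = φ s) ∧
      IsPosDefUpTo (k + 1) Φ ∧
      ∀ a b, wordDist a b = k + 1 → IsOrthogonalValue φ k a b (Φ (a⁻¹ * b)) := by
  classical
  have hval : ∀ s : FreeGp m, s.norm = k + 1 → ∃ X, IsOrthogonalValue φ k 1 s X :=
    fun s hs => exists_isOrthogonalValue hφ (by rw [wordDist_one_left, hs])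
  choose! X hX using hval
  let Φ : FreeGp m → H →L[ℂ] H := fun s => if s.norm = k + 1 then X s else φ s
  have hΦφ : ∀ s : FreeGp m, s.norm ≤ k → Φ s = φ s := fun s hs => if_neg (by omega)
  have horth : ∀ a b, wordDist a b = k + 1 → IsOrthogonalValue φ k a b (Φ (a⁻¹ * b)) := by
    intro a b hab
    have := (hX _ hab).translate a
    rw [mul_one, mul_inv_cancel_left] at this
    have e : Φ (a⁻¹ * b) = X (a⁻¹ * b) := if_pos hab
    rwa [e]
  have hΦ : IsPosDefUpTo k Φ := hφ.congr hΦφ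
  refine ⟨Φ, hΦφ, fun K s hs h => ?_, horth⟩
  by_cases hk : ∀ i j, wordDist (s i) (s j) ≤ k
  · exact hΦ K s hk h
  push Not at hk
  obtain ⟨i₀, j₀, hij⟩ := hk
  have hab : wordDist (s i₀) (s j₀) = k + 1 := le_antisymm (hs _ _) hij
  set a := s i₀
  set b := s j₀
  set B := ballInter k a b with hB
  set Q := Set.range s
  have hQ : ∀ x ∈ Q, ∀ y ∈ Q, wordDist x y ≤ k + 1 := by
    rintro _ ⟨i, rfl⟩ _ ⟨j, rfl⟩
    exact hs i j
  have ha : a ∈ Q := ⟨i₀, rfl⟩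
  have hb : b ∈ Q := ⟨j₀, rfl⟩
  have hBB : ∀ x ∈ B, ∀ y ∈ B, wordDist x y ≤ k := by
    intro x hx y hy
    have h := mem_ballInter.1 hy
    exact wordDist_le_of_mem_ballInter hab hx (by omega) (by omega)
  have hBQ : ∀ x ∈ B, ∀ y ∈ Q, wordDist x y ≤ k := fun x hx y hy =>
    wordDist_le_of_mem_ballInter hab hx (hQ y hy a ha) (hQ y hy b hb)
  have htrans : ∀ x ∈ Q, ∀ y ∈ Q \ B, ∀ z ∈ Q, wordDist x y ≤ k → wordDist y z ≤ k →
      wordDist x z ≤ k := fun x hx y hy z hz =>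
    wordDist_trans_of_not_mem_ballInter hy.2 (hQ x hx a ha) (hQ x hx b hb) (hQ z hz a ha)
      (hQ z hz b hb)
  obtain ⟨R, _, _, _, ω, hω⟩ := exists_isProjectionFamily_ballInter hΦ hab Q
    fun x hx => ⟨hQ x hx a ha, hQ x hx b hb⟩
  -- Off `B` this labels a point by its equivalence class for being within `k`. Points of `B` get
  -- the label `Q \ B`, which is harmless as they are within `k` of everything.
  refine hω.sum_nonneg (A := groupKernel Φ) (fun x => {y ∈ Q \ B | wordDist x y ≤ k})
    (fun c => hΦ.hasRealizationOn ?_) ?_ s (fun i => ⟨i, rfl⟩) h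
  · have hcB : ∀ x ∈ Q, ∀ y ∈ Q, {z ∈ Q \ B | wordDist x z ≤ k} = c →
        {z ∈ Q \ B | wordDist y z ≤ k} = c → wordDist x y ≤ k := by
      intro x hx y hy hxc hyc
      by_cases hyB : y ∈ B
      · exact wordDist_comm x y ▸ hBQ y hyB x hx
      · have : y ∈ c := hyc ▸ ⟨⟨hy, hyB⟩, by simp⟩
        rw [← hxc] at this
        exact this.2
    rintro x (hx | hx) y (hy | hy)
    · exact hBB x hx y hy
    · exact hBQ x hx y hy.1
    · exact wordDist_comm x y ▸ hBQ y hy x hx.1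
    · exact hcB x hx.1 y hy.1 hx.2 hy.2
  · intro x hx y hy hxy g h
    by_cases hxB : x ∈ B
    · exact (hω.inner_eq x hxB y (Or.inr hy) g h).symm
    by_cases hyB : y ∈ B
    · obtain ⟨R', _, _, _, ω', hω'⟩ := hΦ.hasRealizationOn (Q := {x, y}) (by
        have h1 := hBQ y hyB x hx
        have h2 := wordDist_comm x y
        have h3 := wordDist_self x
        have h4 := wordDist_self y
        rintro u (rfl | rfl) v (rfl | rfl) <;> omega)
      rw [← hω' x (by simp) y (by simp), ← inner_conj_symm, hω' y (by simp) x (by simp),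
        ← hω.inner_eq y hyB x (Or.inr hx), inner_conj_symm]
    -- Points off `B` within `k` of each other would have equal labels.
    have hd : wordDist x y = k + 1 := by
      refine le_antisymm (hQ x hx y hy) (Nat.succ_le_of_lt (not_le.1 fun hle => hxy ?_))
      ext z
      refine and_congr_right fun hz => ⟨fun h => ?_, fun h => ?_⟩
      · exact htrans y hy x ⟨hx, hxB⟩ z hz.1 (wordDist_comm x y ▸ hle) h
      · exact htrans x hx y ⟨hy, hyB⟩ z hz.1 hle h
    have hBxy : ballInter k x y = B := ballInter_eq hab hd (hQ x hx a ha) (hQ x hx b hb)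
      (hQ y hy a ha) (hQ y hy b hb)
    refine (((horth x y hd).congr hd hΦφ).inner_eq ?_ ?_ g h).symm
    · rw [hBxy]
      exact condOrth_of_mem y (hω.mem x (Or.inr hx))
    · rw [hBxy]
      intro t ht z hz
      refine hω.inner_eq t ht z ?_
      rcases hz with hz | rfl | rfl
      · exact Or.inl hz
      · exact Or.inr hx
      · exact Or.inr hy

/-- Every positive definite function on `S_n` has a positive definite extension to the free group
in which all pairs of elements at distance `k + 1 > n` are orthogonal modulo the elements at
distance at most `k` from both. -/
theorem IsPosDefUpTo.exists_extension [CompleteSpace H] {n : ℕ} {φ : FreeGp m → H →L[ℂ] H}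
    (hφ : IsPosDefUpTo n φ) :
    ∃ Φ : FreeGp m → H →L[ℂ] H, (∀ s : FreeGp m, s.norm ≤ n → Φ s = φ s) ∧ IsPosDef Φ ∧
      ∀ k, n ≤ k → ∀ a b, wordDist a b = k + 1 → IsOrthogonalValue Φ k a b (Φ (a⁻¹ * b)) := by
  have hstep := fun k (φ : FreeGp m → H →L[ℂ] H) (h : IsPosDefUpTo k φ) => h.exists_succ
  choose! F h1 h2 h3 using hstep
  -- Stage `j` is positive definite on words of length at most `n + j`, and later stages do not
  -- change these values.
  let f : ℕ → FreeGp m → H →L[ℂ] H := fun j => Nat.rec φ (fun j ψ => F (n + j) ψ) j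
  have hf : ∀ j, IsPosDefUpTo (n + j) (f j) := by
    intro j
    induction j with
    | zero => exact hφ
    | succ j ih => exact h2 _ _ ih
  have hle : ∀ i j, i ≤ j → ∀ s : FreeGp m, s.norm ≤ n + i → f j s = f i s := by
    intro i j hij s hs
    induction j, hij using Nat.le_induction with
    | base => rfl
    | succ j hij ih => exact (h1 _ _ (hf j) s (by omega)).trans ih
  -- With truncated subtraction, words of length at most `n` are read off at stage `0`.
  let Φ : FreeGp m → H →L[ℂ] H := fun s => f (s.norm - n) s
  have hΦ : ∀ j, ∀ s : FreeGp m, s.norm ≤ n + j → Φ s = f j s := fun j s hs =>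
    (hle (s.norm - n) j (by omega) s (by omega)).symm
  refine ⟨Φ, fun s hs => hΦ 0 s hs, fun K s h => ?_, fun k hk a b hab => ?_⟩
  · let N := Finset.univ.sup fun p : Fin K × Fin K => wordDist (s p.1) (s p.2)
    have hN : ∀ i j, wordDist (s i) (s j) ≤ n + N := fun i j =>
      (Finset.le_sup (f := fun p : Fin K × Fin K => wordDist (s p.1) (s p.2))
        (Finset.mem_univ (i, j))).trans (Nat.le_add_left _ _)
    exact (hf N).congr (hΦ N) K s hN h
  · obtain ⟨j, rfl⟩ := Nat.exists_eq_add_of_le hk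
    have := (h3 _ _ (hf j) a b hab).congr hab (hΦ j)
    rwa [hΦ (j + 1) _ (show wordDist a b ≤ _ by omega)]

end Extension

section Dilation

variable {m : ℕ} {H : Type u} [NormedAddCommGroup H] [InnerProductSpace ℂ H] [CompleteSpace H]

/-! ### Naimark dilations -/

lemma IsPosDef.exists_realization {Φ : FreeGp m → H →L[ℂ] H} (hΦ : IsPosDef Φ) :
    ∃ (R : Type u) (_ : NormedAddCommGroup R) (_ : InnerProductSpace ℂ R) (_ : CompleteSpace R),
      Nonempty (Realization (groupKernel Φ) R) :=
  nonempty_realization hΦ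

lemma IsPosDef.map_inv {Φ : FreeGp m → H →L[ℂ] H} (hΦ : IsPosDef Φ) (s : FreeGp m) :
    Φ s⁻¹ = (Φ s).adjoint := by
  have := adjoint_eq_of_forall_nonneg (A := groupKernel Φ) hΦ 1 s
  simpa [groupKernel] using this.symm

/-- Left translation of the index preserves the kernel, so it induces unitaries on a realization;
`V` is the operator at index `1`. -/
theorem IsPosDef.exists_minimalNaimarkDilation {Φ : FreeGp m → H →L[ℂ] H} (hΦ : IsPosDef Φ) :
    ∃ (K : Type u) (_ : NormedAddCommGroup K) (_ : InnerProductSpace ℂ K) (_ : CompleteSpace K),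
      Nonempty (MinimalNaimarkDilation Φ K) := by
  obtain ⟨R, _, _, _, ⟨ρ⟩⟩ := hΦ.exists_realization
  have hU : ∀ g : FreeGp m, ∃ U : R →L[ℂ] R, (∀ s h, U (ρ.ω s h) = ρ.ω (g * s) h) ∧
      ∀ x y, ⟪U x, U y⟫_ℂ = ⟪x, y⟫_ℂ := by
    intro g
    obtain ⟨U, hU, -, hU3, -⟩ := exists_intertwiner ρ.ω (fun s => ρ.ω (g * s)) Set.univ
      fun s _ t _ x y => by
        rw [ρ.inner_eq, ρ.inner_eq, groupKernel, groupKernel, mul_inv_rev, mul_assoc,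
          inv_mul_cancel_left]
    exact ⟨U, fun s h => hU s trivial h, fun x y => hU3 x y (ρ.span_eq_top ▸ trivial)⟩
  choose U hU hUin using hU
  have hext : ∀ S T : R →L[ℂ] R, (∀ s h, S (ρ.ω s h) = T (ρ.ω s h)) → S = T := by
    intro S T h
    have hle : closedSpan ρ.ω Set.univ ≤ LinearMap.ker (S - T).toLinearMap :=
      closedSpan_le (ContinuousLinearMap.isClosed_ker _) fun s _ x => by simp [h s x]
    rw [ρ.span_eq_top] at hle
    ext x
    have := hle (Submodule.mem_top (x := x))
    simpa [sub_eq_zero] using this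
  have hU1 : U 1 = ContinuousLinearMap.id ℂ R := hext _ _ fun s h => by simp [hU]
  have hUmul : ∀ g g', U (g * g') = U g ∘L U g' := fun g g' =>
    hext _ _ fun s h => by simp [hU, mul_assoc]
  have hUnorm : ∀ g x, ‖U g x‖ = ‖x‖ := by
    intro g x
    rw [← sq_eq_sq₀ (norm_nonneg _) (norm_nonneg _), ← Complex.ofReal_inj,
      ← inner_self_eq_ofReal_norm_sq, ← inner_self_eq_ofReal_norm_sq, hUin]
  have hUinv : ∀ g, U g ∘L U g⁻¹ = ContinuousLinearMap.id ℂ R := fun g => by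
    rw [← hUmul, mul_inv_cancel, hU1]
  have hUinv' : ∀ g, U g⁻¹ ∘L U g = ContinuousLinearMap.id ℂ R := fun g => by
    rw [← hUmul, inv_mul_cancel, hU1]
  let π : FreeGp m →* (R ≃ₗᵢ[ℂ] R) :=
    { toFun := fun g =>
        { toLinearEquiv := LinearEquiv.ofLinearMap (U g).toLinearMap (U g⁻¹).toLinearMap
            (LinearMap.ext fun x => DFunLike.congr_fun (hUinv g) x)
            (LinearMap.ext fun x => DFunLike.congr_fun (hUinv' g) x)
          norm_map' := hUnorm g }
      map_one' := LinearIsometryEquiv.ext fun x => DFunLike.congr_fun hU1 x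
      map_mul' := fun g g' => LinearIsometryEquiv.ext fun x => DFunLike.congr_fun (hUmul g g') x }
  have hπ : ∀ s, (π s : R →L[ℂ] R) ∘L ρ.ω 1 = ρ.ω s := fun s =>
    ContinuousLinearMap.ext fun x => (hU s 1 x).trans (by rw [mul_one])
  refine ⟨R, inferInstance, inferInstance, inferInstance, ⟨⟨π, ρ.ω 1, fun s => ?_, ?_⟩⟩⟩
  · rw [hπ, ρ.adjoint_comp, groupKernel, inv_one, one_mul]
  · simp only [hπ]
    exact ρ.span_eq_top

lemma MinimalNaimarkDilation.isGramOn_embed {Φ : FreeGp m → H →L[ℂ] H} {K : Type*}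
    [NormedAddCommGroup K] [InnerProductSpace ℂ K] [CompleteSpace K]
    (D : MinimalNaimarkDilation Φ K) : IsGramOn D.embed (groupKernel Φ) Set.univ := by
  intro s _ t _ g h
  have e : D.π t (D.V h) = D.π s (D.π (s⁻¹ * t) (D.V h)) := by
    conv_lhs => rw [← mul_inv_cancel_left s t, map_mul]
    rfl
  change ⟪D.π s (D.V g), D.π t (D.V h)⟫_ℂ = _
  rw [e, LinearIsometryEquiv.inner_map_map, groupKernel, D.dilation,
    ContinuousLinearMap.comp_apply, ContinuousLinearMap.adjoint_inner_right]
  rfl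

/-! ### Maximal orthogonality -/

lemma IsMaximalOrthogonal.exists_condOrth {k : ℕ} {Ψ : FreeGp m → H →L[ℂ] H}
    (hΨ : IsMaximalOrthogonal k Ψ) :
    ∃ (K : Type u) (_ : NormedAddCommGroup K) (_ : InnerProductSpace ℂ K) (_ : CompleteSpace K)
      (ω : FreeGp m → H →L[ℂ] K), IsGramOn ω (groupKernel Ψ) Set.univ ∧
        ∀ a b, wordDist a b = k + 1 → CondOrth ω (ballInter k a b) a b := by
  obtain ⟨K, _, _, _, D, hD⟩ := hΨ
  exact ⟨K, _, _, ‹_›, D.embed, D.isGramOn_embed, fun a b hab =>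
    (spanDiff_isOrtho_iff _ _ _ _).1 (hD a b hab _ rfl)⟩

lemma IsPosDef.isMaximalOrthogonal {k : ℕ} {Φ : FreeGp m → H →L[ℂ] H} (hΦ : IsPosDef Φ)
    (h : ∀ a b, wordDist a b = k + 1 → IsOrthogonalValue Φ k a b (Φ (a⁻¹ * b))) :
    IsMaximalOrthogonal k Φ := by
  obtain ⟨K, _, _, _, ⟨D⟩⟩ := hΦ.exists_minimalNaimarkDilation
  refine ⟨K, _, _, ‹_›, D, fun s t hst S hS => ?_⟩
  subst hS
  exact (spanDiff_isOrtho_iff _ _ _ _).2 ((h s t hst).condOrth D.isGramOn_embed)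

/-- This is the induction step for uniqueness: orthogonality leaves one possible value at each word
of length `k + 1`, computed from shorter words. -/
lemma IsMaximalOrthogonal.eq_of_norm_le {k : ℕ} {Φ Ψ : FreeGp m → H →L[ℂ] H}
    (hΨ : IsMaximalOrthogonal k Ψ)
    (hΦ : ∀ a b, wordDist a b = k + 1 → IsOrthogonalValue Φ k a b (Φ (a⁻¹ * b)))
    (h : ∀ s : FreeGp m, s.norm ≤ k → Ψ s = Φ s) (s : FreeGp m) (hs : s.norm ≤ k + 1) :
    Ψ s = Φ s := by
  rcases Nat.le_or_eq_of_le_succ hs with hs | hs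
  · exact h s hs
  obtain ⟨K, _, _, _, ω, hω, horth⟩ := hΨ.exists_condOrth
  have hd : wordDist 1 s = k + 1 := by rw [wordDist_one_left, hs]
  ext x
  refine ext_inner_left ℂ fun g => ?_
  have h1 := ((hΦ 1 s hd).congr hd h).inner_eq (horth 1 s hd)
    (fun t _ s _ => hω t trivial s trivial) g x
  rw [hω 1 trivial s trivial] at h1
  simpa [groupKernel] using h1

end Dilation

/-! ### Cliques of the graphs of a lexicographic order -/

section Cliques

variable {m : ℕ}

lemma norm_order_min_inv (o : LinearOrder (FreeGp m)) (s : FreeGp m) :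
    (o.min s s⁻¹).norm = s.norm := by
  let := o
  rcases min_choice s s⁻¹ with h | h
  · exact congrArg _ h
  · exact (congrArg _ h).trans FreeGroup.norm_inv_eq

lemma classLE_of_norm_lt {o : LinearOrder (FreeGp m)} (ho : IsLexicographic o) {s t : FreeGp m}
    (h : s.norm < t.norm) : classLE o s t :=
  ho.le_of_norm_lt _ _ (by rwa [norm_order_min_inv, norm_order_min_inv])

lemma norm_le_of_classLE {o : LinearOrder (FreeGp m)} (ho : IsLexicographic o) {s t : FreeGp m}
    (h : classLE o s t) : s.norm ≤ t.norm := by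
  by_contra hlt
  have h2 : classLE o t s := classLE_of_norm_lt ho (not_le.1 hlt)
  have h3 := congrArg FreeGroup.norm (o.le_antisymm _ _ h h2)
  rw [norm_order_min_inv, norm_order_min_inv] at h3
  exact hlt h3.le

lemma wordDist_le_of_isClique {o : LinearOrder (FreeGp m)} (ho : IsLexicographic o)
    {r : FreeGp m} {C : Set (FreeGp m)} (hC : (classGraph o r).IsClique C) {x y : FreeGp m}
    (hx : x ∈ C) (hy : y ∈ C) : wordDist x y ≤ r.norm := by
  by_cases hxy : x = y
  · simp [hxy]
  · exact norm_le_of_classLE ho (hC hx hy hxy).2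

/-- Such a point is within `k` of every element of the clique, so it can be added to it, and
maximality applies. -/
lemma ballInter_subset_of_maximal_isClique {o : LinearOrder (FreeGp m)} (ho : IsLexicographic o)
    {k : ℕ} {r : FreeGp m} (hr : r.norm = k + 1) {C : Set (FreeGp m)}
    (hC : Maximal (classGraph o r).IsClique C) (h1 : 1 ∈ C) (hrC : r ∈ C) :
    ballInter k 1 r ⊆ C := by
  intro x hx
  have hxC : (classGraph o r).IsClique (insert x C) := by
    refine hC.prop.insert fun y hy hxy => ⟨hxy, classLE_of_norm_lt ho ?_⟩
    have := wordDist_le_of_mem_ballInter (by rw [wordDist_one_left, hr]) hx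
      (hr ▸ wordDist_le_of_isClique ho hC.prop hy h1)
      (hr ▸ wordDist_le_of_isClique ho hC.prop hy hrC)
    rw [hr]
    exact Nat.lt_succ_of_le this
  exact hC.le_of_ge hxC (Set.subset_insert x C) (Set.mem_insert x C)

lemma exists_maximal_isClique (o : LinearOrder (FreeGp m)) (r : FreeGp m) :
    ∃ C, Maximal (classGraph o r).IsClique C ∧ 1 ∈ C ∧ r ∈ C := by
  have h0 : (classGraph o r).IsClique {1, r} := by
    have h1 : classLE o (1⁻¹ * r) r := by
      rw [inv_one, one_mul]
      exact o.le_refl _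
    rw [SimpleGraph.isClique_pair]
    exact fun h => ⟨h, h1⟩
  obtain ⟨C, hsub, hC⟩ := zorn_subset_nonempty {C | (classGraph o r).IsClique C} (by
    intro c hc hchain hne
    refine ⟨⋃₀ c, ?_, fun s hs => Set.subset_sUnion_of_mem hs⟩
    rintro x ⟨s, hs, hxs⟩ y ⟨t, ht, hyt⟩ hxy
    rcases hchain.total hs ht with h | h
    · exact hc ht (h hxs) hyt hxy
    · exact hc hs hxs (h hyt) hxy) _ h0
  exact ⟨C, hC, hsub (by simp), hsub (by simp)⟩

end Cliques

section Central

variable {m : ℕ} {H : Type u} [NormedAddCommGroup H] [InnerProductSpace ℂ H]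

/-! ### Parameters -/

lemma CondOrth.comp_iff {I I' K : Type*} [NormedAddCommGroup K] [InnerProductSpace ℂ K]
    (ω : I → H →L[ℂ] K) (f : I' → I) (T : Set I') (a b : I') :
    CondOrth (fun i => ω (f i)) T a b ↔ CondOrth ω (f '' T) (f a) (f b) := by
  simp [CondOrth, closedSpan_image]

lemma orthogonalProjectionOnto_comp_subtypeL_eq_zero_iff {K : Type*} [NormedAddCommGroup K]
    [InnerProductSpace ℂ K] (V W : Submodule ℂ K) [W.HasOrthogonalProjection] :
    W.orthogonalProjectionOnto ∘L V.subtypeL = 0 ↔ V ⟂ W := by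
  rw [Submodule.isOrtho_iff_le]
  constructor
  · intro h x hx
    have h' : W.orthogonalProjectionOnto x = 0 := by
      simpa using congrArg (fun f : V →L[ℂ] W => f ⟨x, hx⟩) h
    exact Submodule.orthogonalProjectionOnto_eq_zero_iff.1 h'
  · intro h
    refine ContinuousLinearMap.ext fun x => ?_
    have h' : W.orthogonalProjectionOnto x = 0 :=
      Submodule.orthogonalProjectionOnto_eq_zero_iff.2 (h x.2)
    simpa using h'

lemma Realization.gamma_eq_zero_iff [CompleteSpace H] {I : Type*} {A : I → I → H →L[ℂ] H}
    {R : Type*} [NormedAddCommGroup R] [InnerProductSpace ℂ R] [CompleteSpace R]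
    (ρ : Realization A R) {k l : I} (hkl : k ≠ l) :
    ρ.gamma k l = 0 ↔ CondOrth ρ.ω {k, l}ᶜ l k := by
  have e1 : ({k}ᶜ : Set I) = {k, l}ᶜ ∪ {l} := by
    ext i
    by_cases h : i = l
    · simp [h, hkl.symm]
    · simp [h]
  have e2 : ({l}ᶜ : Set I) = {k, l}ᶜ ∪ {k} := by
    ext i
    by_cases h : i = k
    · simp [h, hkl]
    · simp [h]
  rw [← spanDiff_isOrtho_iff, ← e1, ← e2]
  exact orthogonalProjectionOnto_comp_subtypeL_eq_zero_iff _ _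

/-- In a set of diameter `k + 1`, orthogonality modulo the elements at distance at most `k` from
both points implies orthogonality modulo all other elements. -/
lemma condOrth_of_wordDist_le {K : Type*} [NormedAddCommGroup K] [InnerProductSpace ℂ K]
    [CompleteSpace K] {ω : FreeGp m → H →L[ℂ] K} {k : ℕ}
    (hω : ∀ a b, wordDist a b = k + 1 → CondOrth ω (ballInter k a b) a b) {C : Set (FreeGp m)}
    (hC : ∀ x ∈ C, ∀ y ∈ C, wordDist x y ≤ k + 1) {a b : FreeGp m} (ha : a ∈ C) (hb : b ∈ C)
    (hab : wordDist a b = k + 1) (hB : ballInter k a b ⊆ C) : CondOrth ω (C \ {a, b}) a b := by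
  intro g
  -- `S` is the separating set together with the rest of the block of `a`. The projection of `ω a g`
  -- to the span over `S` turns out to be its projection over all of `C \ {a}`.
  let S := {x ∈ C | x ≠ a ∧ wordDist x a ≤ k}
  have hBS : ballInter k a b ⊆ S := by
    refine fun x hx => ⟨hB hx, ?_, (mem_ballInter.1 hx).1⟩
    rintro rfl
    have := (mem_ballInter.1 hx).2
    omega
  have hST : S ⊆ C \ {a, b} := by
    rintro x ⟨hx, hxa, hd⟩
    refine ⟨hx, ?_⟩
    rintro (rfl | rfl)
    · exact hxa rfl
    · rw [wordDist_comm] at hd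
      omega
  obtain ⟨p, hp, hpS⟩ := exists_projection ω S (ω a g)
  have hpS' : ∀ y ∈ C, y ≠ a → ∀ h, ⟪ω y h, ω a g - p⟫_ℂ = 0 := by
    intro y hy hya h
    by_cases hyS : y ∈ S
    · exact hpS y hyS h
    have hyd : ¬ wordDist y a ≤ k := fun h => hyS ⟨hy, hya, h⟩
    -- For `y` in another block, the residual of `ω y h` modulo the separating set is orthogonal to
    -- `a` and all of `S`, hence to `ω a g - p`, which is itself orthogonal to the separating set.
    obtain ⟨q, hq, hqB⟩ := exists_projection ω (ballInter k a b) (ω y h)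
    have hz : ∀ z ∈ insert a S, ∀ x, ⟪ω z x, ω y h - q⟫_ℂ = 0 := by
      intro z hz x
      by_cases hzB : z ∈ ballInter k a b
      · exact hqB z hzB x
      have hzC : z ∈ C := by
        rcases hz with rfl | hz
        · exact ha
        · exact hz.1
      have hza : wordDist z a ≤ k := by
        rcases hz with rfl | hz
        · simp
        · exact hz.2.2
      -- Otherwise transitivity through `z` would put `y` in the block of `a`.
      have hyz : wordDist y z = k + 1 := by
        refine le_antisymm (hC y hy z hzC) (Nat.succ_le_of_lt (not_le.1 fun hle => hyd ?_))
        exact wordDist_trans_of_not_mem_ballInter hzB (hC y hy a ha) (hC y hy b hb)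
          (by simp) hab.le hle hza
      obtain ⟨q', hq', hqB', hqz⟩ := hω y z hyz h
      rw [ballInter_eq hab hyz (hC y hy a ha) (hC y hy b hb) (hC z hzC a ha) (hC z hzC b hb)]
        at hq' hqB'
      have hqq : q = q' := eq_of_mem_closedSpan hq hq' fun t ht x => by
        have h1 := hqB t ht x
        have h2 := hqB' t ht x
        rw [inner_sub_right, sub_eq_zero] at h1 h2
        rw [← h1, h2]
      rw [hqq]
      exact hqz x
    have hv : ω a g - p ∈ closedSpan ω (insert a S) :=
      sub_mem (mem_closedSpan ω (Set.mem_insert a S) g)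
        (closedSpan_mono ω (Set.subset_insert a S) hp)
    have h1 := inner_eq_zero_symm.1 (inner_eq_zero_of_mem_closedSpan hz hv)
    have h2 := inner_eq_zero_of_mem_closedSpan (fun t ht => hpS t (hBS ht)) hq
    rwa [inner_sub_left, h2, sub_zero] at h1
  refine ⟨p, closedSpan_mono ω hST hp, fun t ht => ?_, ?_⟩
  · exact hpS' t ht.1 fun h => ht.2 (Or.inl h)
  · refine hpS' b hb ?_
    rintro rfl
    simp at hab

/-- Orthogonality is proved in a realization over the whole group, where the separating sets of all
pairs are available, and then transferred to the realization over `C`. -/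
lemma IsPosDef.condOrth_blockMatrix [CompleteSpace H] {Φ : FreeGp m → H →L[ℂ] H} {k : ℕ}
    (hΦ : ∀ a b, wordDist a b = k + 1 → IsOrthogonalValue Φ k a b (Φ (a⁻¹ * b)))
    (hpos : IsPosDef Φ) {o : LinearOrder (FreeGp m)} (ho : IsLexicographic o) {r : FreeGp m}
    (hr : r.norm = k + 1) {C : Set (FreeGp m)} (hC : Maximal (classGraph o r).IsClique C)
    (h1 : 1 ∈ C) (hrC : r ∈ C) {R : Type*} [NormedAddCommGroup R] [InnerProductSpace ℂ R]
    [CompleteSpace R] (ρ : Realization (blockMatrix Φ C) R) :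
    CondOrth ρ.ω {⟨r, hrC⟩, ⟨1, h1⟩}ᶜ ⟨1, h1⟩ ⟨r, hrC⟩ := by
  obtain ⟨R', _, _, _, ⟨ρ'⟩⟩ := hpos.exists_realization
  have hd : ∀ x ∈ C, ∀ y ∈ C, wordDist x y ≤ k + 1 := fun x hx y hy =>
    hr ▸ wordDist_le_of_isClique ho hC.prop hx hy
  have hρ' := condOrth_of_wordDist_le
    (fun a b hab => (hΦ a b hab).condOrth fun s _ t _ => ρ'.inner_eq s t) hd h1 hrC
    (by rw [wordDist_one_left, hr]) (ballInter_subset_of_maximal_isClique ho hr hC h1 hrC)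
  have himg : (Subtype.val '' ({⟨r, hrC⟩, ⟨1, h1⟩}ᶜ : Set C)) = C \ {1, r} := by
    ext x
    simp only [Set.mem_image, Set.mem_compl_iff, Set.mem_insert_iff, Set.mem_singleton_iff,
      Subtype.exists, Subtype.mk.injEq, exists_and_right, exists_eq_right, Set.mem_sdiff, exists_prop,
      or_comm]
  have hcomp := (CondOrth.comp_iff ρ'.ω (Subtype.val : C → FreeGp m) {⟨r, hrC⟩, ⟨1, h1⟩}ᶜ
    ⟨1, h1⟩ ⟨r, hrC⟩).2 (by rwa [himg])
  exact hcomp.transfer (Set.subset_univ _) trivial trivial fun s _ t _ g h => by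
    rw [ρ'.inner_eq, ρ.inner_eq]
    rfl

lemma IsPosDef.parameterVanishes [CompleteSpace H] {Φ : FreeGp m → H →L[ℂ] H} {k : ℕ}
    (hΦ : ∀ a b, wordDist a b = k + 1 → IsOrthogonalValue Φ k a b (Φ (a⁻¹ * b)))
    (hpos : IsPosDef Φ) {o : LinearOrder (FreeGp m)} (ho : IsLexicographic o) {r : FreeGp m}
    (hr : r.norm = k + 1) : ParameterVanishes o Φ r := by
  obtain ⟨C, hC, h1, hrC⟩ := exists_maximal_isClique o r
  obtain ⟨R, _, _, _, ⟨ρ⟩⟩ := nonempty_realization (A := blockMatrix Φ C)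
    fun K s h => hpos K (fun i => s i) h
  refine ⟨C, hC, h1, hrC, R, _, _, ‹_›, ρ, (ρ.gamma_eq_zero_iff ?_).2
    (hpos.condOrth_blockMatrix hΦ ho hr hC h1 hrC ρ)⟩
  intro h
  have := congrArg Subtype.val h
  simp only at this
  rw [this] at hr
  simp at hr

/-- The parameters of words of length `k + 1` determine the values on words of length `k + 1`. -/
lemma eq_of_parameterVanishes [CompleteSpace H] {Φ Ψ : FreeGp m → H →L[ℂ] H} {k : ℕ}
    (hΦ : ∀ a b, wordDist a b = k + 1 → IsOrthogonalValue Φ k a b (Φ (a⁻¹ * b)))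
    (hpos : IsPosDef Φ) (hΨ : IsPosDef Ψ) {o : LinearOrder (FreeGp m)} (ho : IsLexicographic o)
    (hpar : ∀ r : FreeGp m, r.norm = k + 1 → o.le r r⁻¹ → ParameterVanishes o Ψ r)
    (h : ∀ s : FreeGp m, s.norm ≤ k → Ψ s = Φ s) (s : FreeGp m) (hs : s.norm ≤ k + 1) :
    Ψ s = Φ s := by
  by_contra hne
  -- This set is finite and closed under inversion, so its least element `r` satisfies `r ≤ r⁻¹` and
  -- its parameter is assumed to vanish.
  let bad : Set (FreeGp m) := {s | s.norm = k + 1 ∧ Ψ s ≠ Φ s}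
  have hs_bad : s ∈ bad := ⟨le_antisymm hs (Nat.succ_le_of_lt (not_le.1 fun hle => hne (h s hle))),
    hne⟩
  have hinv : ∀ x ∈ bad, x⁻¹ ∈ bad := by
    rintro x ⟨hx, hx'⟩
    refine ⟨by rw [FreeGroup.norm_inv_eq, hx], fun he => hx' ?_⟩
    rw [hΨ.map_inv, hpos.map_inv] at he
    exact ContinuousLinearMap.adjoint.injective he
  have hfin : bad.Finite := (finite_setOf_norm_eq (k + 1)).subset fun x hx => hx.1
  obtain ⟨r, hr, hmin⟩ : ∃ r ∈ bad, ∀ x ∈ bad, o.le r x := by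
    let := o
    exact Set.exists_min_image bad id hfin ⟨s, hs_bad⟩
  obtain ⟨C, hC, h1, hrC, R, _, _, _, ρ, hρ⟩ := hpar r hr.1 (hmin _ (hinv r hr))
  have hr1 : r ≠ 1 := by
    rintro rfl
    simpa using hr.1
  rw [ρ.gamma_eq_zero_iff fun h => hr1 (congrArg Subtype.val h)] at hρ
  obtain ⟨R', _, _, _, ⟨ρ'⟩⟩ := nonempty_realization (A := blockMatrix Φ C)
    fun K s h => hpos K (fun i => s i) h
  have hρ' := hpos.condOrth_blockMatrix hΦ ho hr.1 hC h1 hrC ρ'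
  have hd : ∀ x ∈ C, ∀ y ∈ C, wordDist x y ≤ r.norm := fun x hx y hy =>
    wordDist_le_of_isClique ho hC.prop hx hy
  -- A disagreement inside `C` has class at most that of `r`, hence equal to it by minimality. The
  -- pair is then a translate of `(1, r)`, up to order, and the diameter of `C` makes the
  -- translation trivial.
  have hagree : ∀ t ∈ C, t ≠ 1 → t ≠ r → ∀ y ∈ C, Ψ (t⁻¹ * y) = Φ (t⁻¹ * y) := by
    intro t ht ht1 htr y hy
    by_contra hbad
    have hdt : wordDist t y = k + 1 := le_antisymm (hr.1 ▸ hd t ht y hy)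
      (Nat.succ_le_of_lt (not_le.1 fun hle => hbad (h _ hle)))
    have hmem : t⁻¹ * y ∈ bad := ⟨hdt, hbad⟩
    have hty : t ≠ y := by
      rintro rfl
      simp at hdt
    have hle : classLE o (t⁻¹ * y) r := (hC.prop ht hy hty).2
    have hor : t⁻¹ * y = r ∨ (t⁻¹ * y)⁻¹ = r := by
      let := o
      have h2 : min (t⁻¹ * y) (t⁻¹ * y)⁻¹ ≤ r := le_trans hle (min_le_left _ _)
      rcases min_le_iff.1 h2 with h3 | h3
      · exact Or.inl (le_antisymm h3 (hmin _ hmem))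
      · exact Or.inr (le_antisymm h3 (hmin _ (hinv _ hmem)))
    rcases hor with hor | hor
    · have hy' : y = t * r := by rw [← hor, mul_inv_cancel_left]
      exact ht1 (eq_one_of_wordDist_le (hy' ▸ hd 1 h1 y hy) (hd t ht r hrC))
    · have ht' : t = y * r := by rw [← hor, mul_inv_rev, inv_inv, mul_inv_cancel_left]
      have hy1 : y = 1 := eq_one_of_wordDist_le (ht' ▸ hd 1 h1 t ht) (hd y hy r hrC)
      exact htr (by rw [ht', hy1, one_mul])
  refine hr.2 (ContinuousLinearMap.ext fun x => ext_inner_left ℂ fun g => ?_)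
  have key := hρ.inner_eq hρ' (fun t ht s _ g x => by
    rw [ρ.inner_eq, ρ'.inner_eq, blockMatrix, blockMatrix, hagree t t.2 ?_ ?_ s s.2]
    · exact fun h => ht (Or.inr (Subtype.ext h))
    · exact fun h => ht (Or.inl (Subtype.ext h))) g x
  rw [ρ.inner_eq, ρ'.inner_eq] at key
  simpa [blockMatrix] using key

end Central

/-! ### Assembly: existence, and uniqueness by induction on the word length. -/

theorem theorem5p3 {m n : ℕ} (hn : 1 ≤ n)
    {H : Type u} [NormedAddCommGroup H] [InnerProductSpace ℂ H] [CompleteSpace H]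
    (φ : wordBall m n → H →L[ℂ] H) (hφ : IsPosDefOn φ) :
    ∃ Φ : FreeGp m → H →L[ℂ] H,
      -- `Φ` is a positive definite extension of `φ`
      IsPosDefExtension φ Φ ∧
      -- for every lexicographic order, `Φ` is the central extension of `φ`
      (∀ o : LinearOrder (FreeGp m), IsLexicographic o →
        ∀ Ψ : FreeGp m → H →L[ℂ] H, IsCentralExtension o φ Ψ ↔ Ψ = Φ) ∧
      -- `Φ` is maximal orthogonal at every level
      (∀ k, n ≤ k → IsMaximalOrthogonal k Φ) ∧
      -- level `n + 1` orthogonality determines an extension of `φ` on words of length `≤ n + 1`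
      (∀ Ψ : FreeGp m → H →L[ℂ] H, IsPosDefExtension φ Ψ → IsMaximalOrthogonal n Ψ →
        ∀ s ∈ wordBall m (n + 1), Ψ s = Φ s) ∧
      -- orthogonality at every level characterizes `Φ` among the extensions of `φ`
      (∀ Ψ : FreeGp m → H →L[ℂ] H, IsPosDefExtension φ Ψ →
        (∀ k, n ≤ k → IsMaximalOrthogonal k Ψ) → Ψ = Φ) := by
  classical
  let φ₀ : FreeGp m → H →L[ℂ] H := fun s => if hs : s ∈ wordBall m n then φ ⟨s, hs⟩ else 0
  have hφ₀ : ∀ s (hs : s ∈ wordBall m n), φ₀ s = φ ⟨s, hs⟩ := fun s hs => dif_pos hs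
  have hpos₀ : IsPosDefUpTo n φ₀ := by
    intro K s hs h
    rcases K with _ | K
    · simp
    -- Translating by the first point brings all points into `S_n` without changing the quotients.
    have e : ∀ i j, ((s 0)⁻¹ * s i)⁻¹ * ((s 0)⁻¹ * s j) = (s i)⁻¹ * s j := fun i j => by group
    have := hφ (K + 1) (fun i => (s 0)⁻¹ * s i) (fun i => hs 0 i)
      (fun i j => by rw [e]; exact hs i j) h
    refine this.trans_eq (Finset.sum_congr rfl fun i _ => Finset.sum_congr rfl fun j _ => ?_)
    rw [← hφ₀, e]
  obtain ⟨Φ, hΦφ, hΦ, horth⟩ := hpos₀.exists_extension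
  have hext : IsPosDefExtension φ Φ := ⟨hΦ, fun s => (hΦφ s s.2).trans (hφ₀ s s.2)⟩
  have hagree : ∀ Ψ, IsPosDefExtension φ Ψ → ∀ s : FreeGp m, s.norm ≤ n → Ψ s = Φ s :=
    fun Ψ hΨ s hs => (hΨ.2 ⟨s, hs⟩).trans (hext.2 ⟨s, hs⟩).symm
  have hind : ∀ Ψ, IsPosDefExtension φ Ψ →
      (∀ k, n ≤ k → (∀ s : FreeGp m, s.norm ≤ k → Ψ s = Φ s) →
        ∀ s : FreeGp m, s.norm ≤ k + 1 → Ψ s = Φ s) → Ψ = Φ := by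
    intro Ψ hΨ hstep
    have hall : ∀ j, ∀ s : FreeGp m, s.norm ≤ n + j → Ψ s = Φ s := by
      intro j
      induction j with
      | zero => exact hagree Ψ hΨ
      | succ j ih => exact hstep _ (Nat.le_add_right n j) ih
    exact funext fun s => hall s.norm s (Nat.le_add_left _ _)
  refine ⟨Φ, hext, fun o ho Ψ => ⟨fun hΨ => ?_, ?_⟩, fun k hk => hΦ.isMaximalOrthogonal (horth k hk),
    fun Ψ hΨ hmax s hs => hmax.eq_of_norm_le (horth n le_rfl) (hagree Ψ hΨ) s hs,
    fun Ψ hΨ hmax => hind Ψ hΨ fun k hk => (hmax k hk).eq_of_norm_le (horth k hk)⟩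
  · refine hind Ψ hΨ.1 fun k hk => eq_of_parameterVanishes (horth k hk) hΦ hΨ.1.1 ho
      fun r hr => hΨ.2 r (by omega)
  · rintro rfl
    refine ⟨hext, fun r hr _ => ?_⟩
    obtain ⟨j, hj⟩ := Nat.exists_eq_add_of_lt hr
    exact hΦ.parameterVanishes (horth (n + j) (Nat.le_add_right n j)) ho hj
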